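/- Let $\sigma_x,\sigma_z$ be Pauli matrices and let $V:\mathbb C^2\to(\mathbb C^2)^{\otimes b}$ be an isometry (the encoder), with noiseless concatenations $V_0=I$, $V_{T+1}=V^{\otimes b^T}V_T$. Let $L_x$ and $L_z$ be operators that are, up to a global phase in $\{\pm1,\pm i\}$, tensor products of $I,\sigma_x,\sigma_z$ over the $b$ qubits (no $\sigma_y$ on any qubit), such that $L_wV=V\sigma_w$ for $w\in\{x,z\}$. For $v,w\in\{x,z\}$ let $n(v\to w)$ be the number of qubits on which $L_v$ acts as $\sigma_w$, let $\mathrm{weight}(L)$ be the number of qubits on which $L$ acts non-trivially, and put $$D_{xz}=\begin{pmatrix} n(x\to x)& n(z\to x)\\ n(x\to z)& n(z\to z)\end{pmatrix},\qquad b_{\max}=\max\{\mathrm{weight}(L_x),\mathrm{weight}(L_z)\},\qquad g_{xz}(T)=\max_{w\in\{x,z\}}(1,1)\,D_{xz}^T\,e_w,$$ with $e_x=(1,0)^{\mathrm T}$, $e_z=(0,1)^{\mathrm T}$, and let $\lambda_{\max}(D_{xz})$ be the spectral radius of $D_{xz}$. Let $p\in[0,1]$, $\mathcal N_w(\rho)=(1-p)\rho+p\,\sigma_w\rho\,\sigma_w$,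 $\mathcal N=\mathcal N_x\circ\mathcal N_z$, $\mathcal V(\rho)=V\rho V^\dagger$, and let $\mathcal E_T=\prod_{j=0}^{T-1}\mathcal N^{\otimes b^{j+1}}\circ\mathcal V^{\otimes b^j}$ (factors with larger $j$ applied later) be the channel of the noisy $b$-ary tree of depth $T$. Then: 1. For every $T\ge 0$ and every single-qubit density operator $\rho$, $\;\|\mathcal E_T(\rho)-\mathcal E_T(I/2)\|_1\le 2\sqrt2\,\sqrt{g_{xz}(T)}\,|1-2p|^T.$ 2. $g_{xz}(T)\le b_{\max}^T$ for every $T\ge0$. 3. For $w\in\{x,z\}$ let $L_w[0]=\sigma_w$ and let $L_w[t+1]$ be obtained from $L_w[t]$ by replacing each tensor factor $\sigma_v$ with $L_v$ and each factor $I$ with $I^{\otimes b}$. Then $L_w[T]\,V_T=V_T\,\sigma_w$ and $\mathrm{weight}(L_w[T])\le g_{xz}(T)$ for every $T\ge 0$. 4. If $(1-2p)^2\min\{\lambda_{\max}(D_{xz}),b_{\max}\}<1$, then in the limit $T\to\infty$ the output of $\mathcal E_T$ becomes independent of the input: $\|\mathcal E_T(\rho)-\mathcal E_T(\rho')\|_1\to0$,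 uniformly over single-qubit density operators $\rho,\rho'$. 5. (Anti-standard encoders.) If $L_x$ contains no $\sigma_x$ and $L_z$ contains no $\sigma_z$, then with $d_x=\mathrm{weight}(L_x)$ and $d_z=\mathrm{weight}(L_z)$ one has $\lambda_{\max}(D_{xz})=\sqrt{d_xd_z}$ and $g_{xz}(T)=\max\{d_x^{\lceil T/2\rceil}d_z^{\lfloor T/2\rfloor},\,d_z^{\lceil T/2\rceil}d_x^{\lfloor T/2\rfloor}\}$ for every $T\ge0$, and the conclusion of 4 holds whenever $(1-2p)^2\sqrt{d_xd_z}<1$. -/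

import Mathlib

open Matrix

noncomputable section

open scoped ComplexOrder

namespace QuantumTree

/-- Operators (in particular density operators) on a single qubit. -/
abbrev QubitOp := Matrix (Fin 2) (Fin 2) ℂ

/-- The Pauli matrix `σ_x`. -/
def pauliX : QubitOp := !![0, 1; 1, 0]

/-- The Pauli matrix `σ_z`. -/
def pauliZ : QubitOp := !![1, 0; 0, -1]

/-- Operators on a register of qubits that are labelled by `ι`; the computational basis is
indexed by the bit strings `ι → Fin 2`. -/
abbrev RegOp (ι : Type) := Matrix (ι → Fin 2) (ι → Fin 2) ℂ

/-- Density operators: positive semidefinite with unit trace. -/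
def IsDensity {n : Type} [Fintype n] (ρ : Matrix n n ℂ) : Prop :=
  ρ.PosSemidef ∧ ρ.trace = 1

/-- The trace norm `‖A‖₁ = tr √(A†A)`, i.e. the sum of the singular values of `A`. -/
def traceNorm {n : Type} [Fintype n] [DecidableEq n] (A : Matrix n n ℂ) : ℝ :=
  ∑ i, √((isHermitian_conjTranspose_mul_self A).eigenvalues i)

/-! ### Noise -/

/-- The single-qubit channel `ρ ↦ (1 - p) ρ + p P ρ P` (for a Pauli matrix `P`). -/
def flipChannel (P : QubitOp) (p : ℝ) : QubitOp →ₗ[ℂ] QubitOp :=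
  (1 - (p : ℂ)) • LinearMap.id + (p : ℂ) • (LinearMap.mulLeft ℂ P ∘ₗ LinearMap.mulRight ℂ P)

/-- Independent bit-flip and phase-flip errors, `𝒩 = 𝒩_x ∘ 𝒩_z`, with `p_x = p_z = p`. -/
def xzNoise (p : ℝ) : QubitOp →ₗ[ℂ] QubitOp :=
  flipChannel pauliX p ∘ₗ flipChannel pauliZ p

/-- The tensor power `𝒩^{⊗ι}` of a single-qubit map `𝒩`: the linear map that sends
`⊗ᵢ |xᵢ⟩⟨x'ᵢ|` to `⊗ᵢ 𝒩(|xᵢ⟩⟨x'ᵢ|)`. -/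
def tensorMap (ι : Type) [Fintype ι] [DecidableEq ι] (N : QubitOp →ₗ[ℂ] QubitOp)
    (ρ : RegOp ι) : RegOp ι :=
  Matrix.of fun y y' => ∑ x, ∑ x', (∏ i, N (Matrix.single (x i) (x' i) 1) (y i) (y' i)) * ρ x x'

/-! ### The tree -/

/-- The nodes at level `t` of the full `b`-ary tree, as paths from the root; there are `b ^ t`
of them. -/
abbrev Node (b t : ℕ) := Fin t → Fin b

/-- The `k`-th child of a node. -/
def child {b t : ℕ} (u : Node b t) (k : Fin b) : Node b (t + 1) :=
  Fin.snoc (α := fun _ => Fin b) u k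

/-- `V^{⊗ b^t}`, from the qubits at level `t` to the qubits at level `t + 1`: the qubit at each
node is encoded in the qubits at its children. -/
def encoderLayer {b : ℕ} (V : Matrix (Fin b → Fin 2) (Fin 2) ℂ) (t : ℕ) :
    Matrix (Node b (t + 1) → Fin 2) (Node b t → Fin 2) ℂ :=
  Matrix.of fun y x => ∏ u : Node b t, V (fun k => y (child u k)) (x u)

/-- The noiseless encoder `V_T = V^{⊗ b^{T-1}} ⋯ V^{⊗ b} V`, an isometry from the qubit at the
root (level `0` has a single node) to the `b ^ T` leaves. -/
def treeIsometry {b : ℕ} (V : Matrix (Fin b → Fin 2) (Fin 2) ℂ) :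
    (T : ℕ) → Matrix (Node b T → Fin 2) (Fin 2) ℂ
  | 0 => (1 : QubitOp).submatrix (fun y => y default) id
  | T + 1 => encoderLayer V T * treeIsometry V T

/-- The noisy tree channel `ℰ_T = ∏_{j<T} 𝒩^{⊗ b^{j+1}} ∘ 𝒱^{⊗ b^j}`, where
`𝒱(ρ) = V ρ V†`. There is no noise at the root. -/
def treeChannel {b : ℕ} (N : QubitOp →ₗ[ℂ] QubitOp) (V : Matrix (Fin b → Fin 2) (Fin 2) ℂ) :
    (T : ℕ) → QubitOp → RegOp (Node b T)
  | 0, ρ => ρ.submatrix (fun y => y default) (fun y => y default)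
  | T + 1, ρ => tensorMap (Node b (T + 1)) N
      (encoderLayer V T * treeChannel N V T ρ * (encoderLayer V T)ᴴ)

/-! ### Pauli operators without `σ_y` -/

/-- The single-qubit Pauli operators other than `σ_y`. -/
inductive Letter
  | I
  | X
  | Z
  deriving DecidableEq

/-- The matrix of a letter. -/
def Letter.toOp : Letter → QubitOp
  | .I => 1
  | .X => pauliX
  | .Z => pauliZ

/-- A tensor product, over the qubits labelled by `ι`, of operators `I`, `σ_x`, `σ_z`, up to a
global phase in `{1, -1, i, -i}`. -/
structure XZString (ι : Type) where
  /-- the global phase -/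
  phase : ℂ
  phase_pow : phase ^ 4 = 1
  /-- the operator that acts on each qubit -/
  letter : ι → Letter

namespace XZString

variable {ι : Type} [Fintype ι]

/-- The operator on the register. -/
def toOp (L : XZString ι) : RegOp ι :=
  L.phase • Matrix.of fun y x => ∏ i, (L.letter i).toOp (y i) (x i)

/-- The number of qubits on which the operator acts as `a`. -/
def count (L : XZString ι) (a : Letter) : ℕ :=
  (Finset.univ.filter fun i => L.letter i = a).card

/-- The number of qubits on which the operator acts non-trivially. -/
def weight (L : XZString ι) : ℕ :=
  (Finset.univ.filter fun i => L.letter i ≠ Letter.I).card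

end XZString

/-- `L` is a logical `σ` operator for `V`, i.e. `L V = V σ`. -/
def IsLogical {ι : Type} [Fintype ι] [DecidableEq ι] (V : Matrix (ι → Fin 2) (Fin 2) ℂ)
    (L : XZString ι) (σ : QubitOp) : Prop :=
  L.toOp * V = V * σ

section Concatenation

variable {b : ℕ} (Lx Lz : XZString (Fin b))

/-- The logical operator `L_a` that replaces the letter `a` (`L_I` is the identity). -/
def substitute : Letter → XZString (Fin b)
  | .I => ⟨1, one_pow 4, fun _ => Letter.I⟩
  | .X => Lx
  | .Z => Lz

/-- The concatenated logical operators: `L_w[0] = σ_w`, and `L_w[t+1]` is obtained from `L_w[t]`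
by replacing the operator `σ_a` on each qubit with `L_a` on the children of that qubit. -/
def concatLogical (w : Letter) : (t : ℕ) → XZString (Node b t)
  | 0 => ⟨1, one_pow 4, fun _ => w⟩
  | t + 1 =>
    { phase := (concatLogical w t).phase *
        ∏ u, (substitute Lx Lz ((concatLogical w t).letter u)).phase
      phase_pow := by
        rw [mul_pow, (concatLogical w t).phase_pow, one_mul, ← Finset.prod_pow]
        exact Finset.prod_eq_one fun u _ => XZString.phase_pow _
      letter := fun v =>
        (substitute Lx Lz ((concatLogical w t).letter (Fin.init v))).letter (v (Fin.last t)) }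

/-- The weight transition matrix, with rows and columns in the order `x`, `z`; the entry in
row `w` and column `v` is `n(v → w)`. -/
def weightMatrix : Matrix (Fin 2) (Fin 2) ℕ :=
  !![Lx.count .X, Lz.count .X; Lx.count .Z, Lz.count .Z]

/-- The spectral radius of the weight transition matrix. -/
def lambdaMax : ℝ :=
  (spectralRadius ℂ ((weightMatrix Lx Lz).map (Nat.cast : ℕ → ℂ))).toReal

/-- The maximum weight of the two logical operators. -/
def bMax : ℕ := max Lx.weight Lz.weight

/-- `g(T) = max_w (1,1) D^T e_w`. -/
def gxz (T : ℕ) : ℕ :=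
  max (![1, 1] ⬝ᵥ (weightMatrix Lx Lz ^ T *ᵥ ![1, 0]))
    (![1, 1] ⬝ᵥ (weightMatrix Lx Lz ^ T *ᵥ ![0, 1]))

end Concatenation

/-- The output of the tree becomes independent of the input as the depth grows: the trace
distance between the outputs for any two inputs tends to `0`, uniformly in the inputs. -/
def OutputBecomesIndependent {b : ℕ} (N : QubitOp →ₗ[ℂ] QubitOp)
    (V : Matrix (Fin b → Fin 2) (Fin 2) ℂ) : Prop :=
  ∀ ε : ℝ, 0 < ε → ∃ T₀ : ℕ, ∀ T, T₀ ≤ T → ∀ ρ ρ' : QubitOp, IsDensity ρ → IsDensity ρ' →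
    traceNorm (treeChannel N V T ρ - treeChannel N V T ρ') < ε

end QuantumTree

end

open QuantumTree

noncomputable section

open scoped ComplexOrder

namespace QuantumTree

/-! ### The trace norm -/

/-! The quantum problem reduces to a classical broadcasting problem on the tree. Pauli noise is a
random Pauli error, and the logical operators let errors be pushed through every encoder to the
leaves, up to phases that conjugation removes. With error `e₀` at the root, the output is therefore
a mixture, with weights `errKernel`, of fixed error strings acting on the noiselessly encoded state
(`treeChannel_conj_errOp`). Since `I/2` is the uniform Pauli average of any trace-one input, the two
outputs mix the same states. Their trace distance is at most the ℓ¹ distance between classical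
distributions (`traceNorm_sum_smul_le`).

That distance is controlled by the squared Hellinger distance `1 - bc`. It contracts by `(1 - 2p)²`
under a bit flip, and it is subadditive over the independent children. Without `σ_y`, flipping one
bit of the parent's error flips at most one bit on each child. So the pair of worst-case distances
for an `x` flip and a `z` flip is multiplied on the right by `(1 - 2p)² D` at each level
(`one_sub_bc_childObs_le`). Iterating gives `(1 - 2p)^(2T) (1,1) D^T e_w`, and the square root gives
the bound.

The same matrix counts letters in the concatenated logical operators. The threshold follows from the
growth of `D^T`, through Gelfand's formula or through its column sums. -/

theorem traceNorm_eq_sum_abs_eigenvalues {n : Type} [Fintype n] [DecidableEq n]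
    {A : Matrix n n ℂ} (hA : A.IsHermitian) : traceNorm A = ∑ i, |hA.eigenvalues i| := by
  have h1 : (Aᴴ * A).charpoly =
      ∏ i, (Polynomial.X - Polynomial.C (((hA.eigenvalues i) ^ 2 : ℝ) : ℂ)) := by
    have : Aᴴ * A = Unitary.conjStarAlgAut ℂ _ hA.eigenvectorUnitary
        (diagonal (fun i => (((hA.eigenvalues i) ^ 2 : ℝ) : ℂ))) := by
      rw [hA.eq]
      conv_lhs => rw [hA.spectral_theorem, ← map_mul]
      rw [diagonal_mul_diagonal]
      congr 2
      ext i
      simp [sq]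
    rw [this, Unitary.conjStarAlgAut_apply, charpoly_mul_comm, ← mul_assoc]
    simp [charpoly_diagonal]
  -- The two eigenvalue lists are enumerated independently, so they are compared as multisets of
  -- roots of the characteristic polynomial.
  have h2 := (isHermitian_conjTranspose_mul_self A).roots_charpoly_eq_eigenvalues
  rw [h1, Polynomial.roots_prod _ _
    (Finset.prod_ne_zero_iff.2 fun i _ => Polynomial.X_sub_C_ne_zero _)] at h2
  simp only [Polynomial.roots_X_sub_C, Multiset.bind_singleton] at h2
  have h3 := congrArg (fun m : Multiset ℂ => (m.map fun z : ℂ => √z.re).sum) h2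
  simp only [Multiset.map_map] at h3
  simp only [traceNorm]
  change ∑ i, √((((hA.eigenvalues i) ^ 2 : ℝ) : ℂ).re) =
    ∑ i, √((((isHermitian_conjTranspose_mul_self A).eigenvalues i : ℝ) : ℂ).re) at h3
  simpa only [Complex.ofReal_re, Real.sqrt_sq_eq_abs] using h3.symm

/-- In an eigenbasis of the sum, each `σ i` has a probability vector on its diagonal, and the
eigenvalues are the `c`-combination of these vectors. The scalar triangle inequality then suffices.
-/
theorem traceNorm_sum_smul_le {n ι : Type} [Fintype n] [DecidableEq n] [Fintype ι]
    (c : ι → ℝ) (σ : ι → Matrix n n ℂ) (hσ : ∀ i, IsDensity (σ i)) :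
    traceNorm (∑ i, (c i : ℂ) • σ i) ≤ ∑ i, |c i| := by
  have hA : (∑ i, (c i : ℂ) • σ i).IsHermitian := by
    simp only [IsHermitian, conjTranspose_sum, conjTranspose_smul, (hσ _).1.isHermitian.eq]
    simp
  rw [traceNorm_eq_sum_abs_eigenvalues hA]
  set U : Matrix n n ℂ := (hA.eigenvectorUnitary : Matrix n n ℂ)
  have hUU : U * Uᴴ = 1 := Unitary.coe_mul_star_self _
  have hd := hA.conjStarAlgAut_star_eigenvectorUnitary
  rw [Unitary.conjStarAlgAut_star_apply] at hd
  change Uᴴ * _ * U = _ at hd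
  have hpsd : ∀ i, (Uᴴ * σ i * U).PosSemidef := fun i => (hσ i).1.conjTranspose_mul_mul_same U
  have htr : ∀ i, (Uᴴ * σ i * U).trace = 1 := fun i => by
    rw [trace_mul_comm, ← mul_assoc, hUU, one_mul, (hσ i).2]
  have key : ∀ j, hA.eigenvalues j = ∑ i, c i * ((Uᴴ * σ i * U) j j).re := fun j => by
    have h : ((hA.eigenvalues j : ℝ) : ℂ) = ∑ i, (c i : ℂ) * (Uᴴ * σ i * U) j j := by
      have h := congrFun (congrFun hd j) j
      rw [diagonal_apply_eq] at h
      refine h.symm.trans ?_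
      rw [Finset.mul_sum, Finset.sum_mul, Matrix.sum_apply]
      simp
    simpa using congrArg Complex.re h
  calc ∑ j, |hA.eigenvalues j| ≤ ∑ j, ∑ i, |c i| * ((Uᴴ * σ i * U) j j).re := by
        refine Finset.sum_le_sum fun j _ => ?_
        rw [key]
        refine (Finset.abs_sum_le_sum_abs _ _).trans (Finset.sum_le_sum fun i _ => ?_)
        rw [abs_mul, abs_of_nonneg (a := Complex.re _)]
        exact (Complex.nonneg_iff.1 ((hpsd i).diag_nonneg (i := j))).1
    _ = ∑ i, |c i| * (Uᴴ * σ i * U).trace.re := by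
        rw [Finset.sum_comm]
        simp only [trace, diag_apply, Complex.re_sum, Finset.mul_sum]
    _ = ∑ i, |c i| := by simp [htr]

theorem IsDensity.conj {m n : Type} [Fintype m] [Fintype n] [DecidableEq n] {ρ : Matrix n n ℂ}
    (hρ : IsDensity ρ) {A : Matrix m n ℂ} (hA : Aᴴ * A = 1) : IsDensity (A * ρ * Aᴴ) :=
  ⟨hρ.1.mul_mul_conjTranspose_same A, by
    rw [trace_mul_comm, ← Matrix.mul_assoc, hA, Matrix.one_mul, hρ.2]⟩

/-! ### Tensor products of families of matrices -/

/-- The tensor product `⊗ᵢ Mᵢ`. -/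
def kron {ι α β : Type} [Fintype ι] (M : ι → Matrix α β ℂ) : Matrix (ι → α) (ι → β) ℂ :=
  of fun y x => ∏ i, M i (y i) (x i)

section kron

variable {ι α β γ : Type} [Fintype ι]

theorem kron_mul [DecidableEq ι] [Fintype β] (M : ι → Matrix α β ℂ) (N : ι → Matrix β γ ℂ) :
    kron M * kron N = kron fun i => M i * N i := by
  ext y x
  simp only [kron, mul_apply, of_apply, ← Finset.prod_mul_distrib]
  rw [Finset.prod_univ_sum, Fintype.piFinset_univ]

theorem kron_smul (c : ι → ℂ) (M : ι → Matrix α β ℂ) :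
    (kron fun i => c i • M i) = (∏ i, c i) • kron M := by
  ext y x
  simp [kron, Finset.prod_mul_distrib]

theorem kron_conjTranspose (M : ι → Matrix α β ℂ) : (kron M)ᴴ = kron fun i => (M i)ᴴ := by
  ext y x
  simp [kron]

theorem kron_one [DecidableEq ι] [DecidableEq α] :
    (kron fun _ : ι => (1 : Matrix α α ℂ)) = 1 := by
  ext y x
  simp only [kron, of_apply, one_apply, funext_iff]
  simp [Finset.prod_ite_zero]

end kron

/-! ### Tree levels and encoder layers -/

/-- The bijection between nodes below the root and pairs (parent, birth rank). -/
def childEquiv (b t : ℕ) : Node b t × Fin b ≃ Node b (t + 1) where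
  toFun q := child q.1 q.2
  invFun v := (Fin.init v, v (Fin.last t))
  left_inv q := by simp [child]
  right_inv v := by simp [child]

/-- Labellings of level `t + 1`, grouped by parent. -/
def groupEquiv (b t : ℕ) (A : Type) : (Node b (t + 1) → A) ≃ (Node b t → Fin b → A) :=
  ((childEquiv b t).symm.arrowCongr (Equiv.refl A)).trans (Equiv.curry _ _ _)

theorem groupEquiv_apply {b t : ℕ} {A : Type} (y : Node b (t + 1) → A) (u : Node b t) (k : Fin b) :
    groupEquiv b t A y u k = y (child u k) := rfl

theorem prod_node_succ {b t : ℕ} {R : Type} [CommMonoid R] (f : Node b (t + 1) → R) :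
    ∏ v, f v = ∏ u : Node b t, ∏ k, f (child u k) := by
  rw [← (childEquiv b t).prod_comp, Fintype.prod_prod_type]
  rfl

theorem encoderLayer_eq {b : ℕ} (V : Matrix (Fin b → Fin 2) (Fin 2) ℂ) (t : ℕ) :
    encoderLayer V t = (kron fun _ => V).submatrix (groupEquiv b t (Fin 2)) id := rfl

theorem kron_node_succ {b t : ℕ} (M : Node b (t + 1) → QubitOp) :
    kron M = (kron fun u => kron fun k => M (child u k)).submatrix
      (groupEquiv b t (Fin 2)) (groupEquiv b t (Fin 2)) := by
  ext y x
  simp [kron, prod_node_succ, groupEquiv_apply]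

/-- Operators on the children that implement `Sᵤ` on the parents. -/
theorem kron_mul_encoderLayer {b t : ℕ} {V : Matrix (Fin b → Fin 2) (Fin 2) ℂ}
    {M : Node b (t + 1) → QubitOp} {S : Node b t → QubitOp} {c : Node b t → ℂ}
    (h : ∀ u, c u • (kron (fun k => M (child u k)) * V) = V * S u) :
    (∏ u, c u) • (kron M * encoderLayer V t) = encoderLayer V t * kron S := by
  rw [kron_node_succ, encoderLayer_eq, submatrix_mul_equiv, kron_mul]
  have h2 : (∏ u, c u) • kron (fun u => kron (fun k => M (child u k)) * V) =
      kron fun u => V * S u := by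
    rw [← kron_smul]
    simp only [h]
  change ((∏ u, c u) • kron (fun u => kron (fun k => M (child u k)) * V)).submatrix _ id = _
  rw [h2, ← kron_mul]
  rfl

theorem encoderLayer_isometry {b : ℕ} {V : Matrix (Fin b → Fin 2) (Fin 2) ℂ} (hV : Vᴴ * V = 1)
    (t : ℕ) : (encoderLayer V t)ᴴ * encoderLayer V t = 1 := by
  rw [encoderLayer_eq, conjTranspose_submatrix, submatrix_mul_equiv, kron_conjTranspose, kron_mul]
  simp only [hV, kron_one, submatrix_id_id]

theorem treeIsometry_isometry {b : ℕ} {V : Matrix (Fin b → Fin 2) (Fin 2) ℂ} (hV : Vᴴ * V = 1)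
    (T : ℕ) : (treeIsometry V T)ᴴ * treeIsometry V T = 1 := by
  induction T with
  | zero =>
    have := submatrix_mul_equiv (1 : QubitOp)ᴴ (1 : QubitOp) id
      (Equiv.funUnique (Node b 0) (Fin 2)) id
    simpa [treeIsometry] using this
  | succ T ih =>
    rw [treeIsometry, conjTranspose_mul, Matrix.mul_assoc, ← Matrix.mul_assoc (encoderLayer V T)ᴴ,
      encoderLayer_isometry hV, Matrix.one_mul, ih]

/-! ### Pauli errors -/

/-- Pauli errors modulo phases: the exponents of `σ_x` and of `σ_z`. -/
abbrev PauliBits := ZMod 2 × ZMod 2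

/-- The error `σ_x^a σ_z^c`. -/
def errOp (e : PauliBits) : QubitOp :=
  (if e.1 = 0 then 1 else pauliX) * (if e.2 = 0 then 1 else pauliZ)

/-- The exponents of a letter. -/
def Letter.bits : Letter → PauliBits
  | .I => 0
  | .X => (1, 0)
  | .Z => (0, 1)

theorem zmod_two_cases (a : ZMod 2) : a = 0 ∨ a = 1 := by
  fin_cases a
  · exact Or.inl rfl
  · exact Or.inr rfl

theorem sum_zmod_two {M : Type*} [AddCommMonoid M] (f : ZMod 2 → M) : ∑ a, f a = f 0 + f 1 :=
  Fin.sum_univ_two f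

theorem errOp_bits (a : Letter) : errOp a.bits = a.toOp := by
  cases a <;> simp [errOp, Letter.bits, Letter.toOp]

theorem pauliX_mul_self : pauliX * pauliX = 1 := by
  simp [pauliX, one_fin_two]

theorem pauliZ_mul_self : pauliZ * pauliZ = 1 := by
  simp [pauliZ, one_fin_two]

theorem pauliZ_mul_pauliX : pauliZ * pauliX = -(pauliX * pauliZ) := by
  simp [pauliZ, pauliX]

theorem pauliX_conjTranspose : pauliXᴴ = pauliX := by
  ext i j
  fin_cases i <;> fin_cases j <;> simp [pauliX]

theorem pauliZ_conjTranspose : pauliZᴴ = pauliZ := by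
  ext i j
  fin_cases i <;> fin_cases j <;> simp [pauliZ]

/-- Equality of matrices up to a phase. -/
def PhaseEq {m n : Type} (A B : Matrix m n ℂ) : Prop :=
  ∃ c : ℂ, c * star c = 1 ∧ A = c • B

namespace PhaseEq

variable {m n l : Type} {A B C : Matrix m n ℂ}

theorem refl (A : Matrix m n ℂ) : PhaseEq A A := ⟨1, by simp, by simp⟩

theorem trans (h : PhaseEq A B) (h' : PhaseEq B C) : PhaseEq A C := by
  obtain ⟨c, hc, rfl⟩ := h
  obtain ⟨d, hd, rfl⟩ := h'
  refine ⟨c * d, ?_, by rw [smul_smul]⟩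
  rw [star_mul', mul_mul_mul_comm, hc, hd, one_mul]

theorem mul_left [Fintype m] (h : PhaseEq A B) (M : Matrix l m ℂ) : PhaseEq (M * A) (M * B) := by
  obtain ⟨c, hc, rfl⟩ := h
  exact ⟨c, hc, by simp⟩

theorem mul_right [Fintype n] (h : PhaseEq A B) (M : Matrix n l ℂ) : PhaseEq (A * M) (B * M) := by
  obtain ⟨c, hc, rfl⟩ := h
  exact ⟨c, hc, by simp⟩

/-- A unit phase cancels against its conjugate, which is why errors need to be tracked only modulo
phases. -/
theorem conj_eq [Fintype n] (h : PhaseEq A B) (ρ : Matrix n n ℂ) : A * ρ * Aᴴ = B * ρ * Bᴴ := by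
  obtain ⟨c, hc, rfl⟩ := h
  rw [conjTranspose_smul, Matrix.smul_mul, Matrix.smul_mul, Matrix.mul_smul, smul_smul, hc,
    one_smul]

theorem kron {ι α β : Type} [Fintype ι] {M N : ι → Matrix α β ℂ} (h : ∀ i, PhaseEq (M i) (N i)) :
    PhaseEq (kron M) (kron N) := by
  choose c hc hM using h
  refine ⟨∏ i, c i, ?_, ?_⟩
  · rw [star_prod, ← Finset.prod_mul_distrib]
    exact Finset.prod_eq_one fun i _ => hc i
  · rw [← kron_smul]
    congr 1
    exact funext hM

end PhaseEq

/-- `σ_x` and `σ_z` are involutions that anticommute, so reordering a product costs only a sign. -/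
theorem errOp_mul (e f : PauliBits) : PhaseEq (errOp e * errOp f) (errOp (e + f)) := by
  have h11 : (1 : ZMod 2) + 1 = 0 := rfl
  have hX := fun M : QubitOp => by
    simpa [Matrix.mul_assoc] using congrArg (fun A : QubitOp => A * M) pauliX_mul_self
  have hZX := fun M : QubitOp => by
    simpa [Matrix.mul_assoc] using congrArg (fun A : QubitOp => A * M) pauliZ_mul_pauliX
  obtain ⟨a, c⟩ := e
  obtain ⟨a', c'⟩ := f
  rcases zmod_two_cases a with rfl | rfl <;> rcases zmod_two_cases c with rfl | rfl <;>
  rcases zmod_two_cases a' with rfl | rfl <;> rcases zmod_two_cases c' with rfl | rfl <;>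
  simp only [errOp, Prod.mk_add_mk, h11, add_zero, zero_add, if_true, one_ne_zero, if_false,
    Matrix.mul_one, Matrix.one_mul, pauliX_mul_self, pauliZ_mul_self, pauliZ_mul_pauliX,
    Matrix.mul_assoc, hX, hZX, Matrix.mul_neg] <;>
  first
  | exact PhaseEq.refl _
  | exact ⟨-1, by simp, by simp⟩

theorem errOp_isometry (e : PauliBits) : (errOp e)ᴴ * errOp e = 1 := by
  obtain ⟨a, c⟩ := e
  have hX := fun M : QubitOp => by
    simpa [Matrix.mul_assoc] using congrArg (fun A : QubitOp => A * M) pauliX_mul_self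
  rcases zmod_two_cases a with rfl | rfl <;> rcases zmod_two_cases c with rfl | rfl <;>
  simp [errOp, pauliX_conjTranspose, pauliZ_conjTranspose, pauliX_mul_self, pauliZ_mul_self,
    Matrix.mul_assoc, hX]

/-- The error on the register. -/
def errString {ι : Type} [Fintype ι] (e : ι → PauliBits) : RegOp ι := kron fun i => errOp (e i)

theorem errString_isometry {ι : Type} [Fintype ι] [DecidableEq ι] (e : ι → PauliBits) :
    (errString e)ᴴ * errString e = 1 := by
  rw [errString, kron_conjTranspose, kron_mul]
  simp only [errOp_isometry, kron_one]

theorem errString_mul {ι : Type} [Fintype ι] [DecidableEq ι] (e f : ι → PauliBits) :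
    PhaseEq (errString e * errString f) (errString (e + f)) := by
  rw [errString, errString, kron_mul]
  exact PhaseEq.kron fun i => errOp_mul _ _

/-! ### The noise as a random error -/

/-- The probability of a single bit of the error. -/
def bitProb (p : ℝ) (a : ZMod 2) : ℝ := if a = 0 then 1 - p else p

/-- The probability of a Pauli error on one qubit. -/
def errProb (p : ℝ) (e : PauliBits) : ℝ := bitProb p e.1 * bitProb p e.2

theorem xzNoise_apply (p : ℝ) (A : QubitOp) :
    xzNoise p A = ∑ e, (errProb p e : ℂ) • (errOp e * A * (errOp e)ᴴ) := by
  simp only [xzNoise, flipChannel, LinearMap.comp_apply, LinearMap.add_apply, LinearMap.smul_apply,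
    LinearMap.id_apply, LinearMap.mulLeft_apply, LinearMap.mulRight_apply, Fintype.sum_prod_type,
    sum_zmod_two, errProb, bitProb, errOp, if_true, one_ne_zero, if_false, Matrix.one_mul,
    Matrix.mul_one, conjTranspose_mul, pauliX_conjTranspose, pauliZ_conjTranspose,
    conjTranspose_one, Matrix.mul_add, Matrix.add_mul, Matrix.mul_smul, Matrix.smul_mul,
    Matrix.mul_assoc, smul_add, smul_smul]
  push_cast
  abel_nf

/-- Independent noise on the qubits is a random error string: expanding the product over qubits of
sums over errors gives one term per string. -/
theorem tensorMap_xzNoise (ι : Type) [Fintype ι] [DecidableEq ι] (p : ℝ) (ρ : RegOp ι) :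
    tensorMap ι (xzNoise p) ρ =
      ∑ n : ι → PauliBits, ((∏ i, errProb p (n i) : ℝ) : ℂ) •
        (errString n * ρ * (errString n)ᴴ) := by
  ext y y'
  have h1 : ∀ (x x' : ι → Fin 2) (i : ι), xzNoise p (Matrix.single (x i) (x' i) 1) (y i) (y' i) =
      ∑ e, (errProb p e : ℂ) * (errOp e (y i) (x i) * star (errOp e (y' i) (x' i))) := by
    intro x x' i
    rw [xzNoise_apply, Matrix.sum_apply]
    refine Finset.sum_congr rfl fun e _ => ?_
    rw [Matrix.smul_apply, smul_eq_mul, Matrix.mul_apply]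
    simp [Matrix.mul_apply, Matrix.single_apply, ite_and]
  simp only [tensorMap, of_apply, h1]
  have h2 : ∀ x x' : ι → Fin 2, ∏ i, ∑ e, (errProb p e : ℂ) *
      (errOp e (y i) (x i) * star (errOp e (y' i) (x' i))) =
      ∑ n : ι → PauliBits, (∏ i, (errProb p (n i) : ℂ)) *
        (errString n y x * star (errString n y' x')) := by
    intro x x'
    rw [Finset.prod_univ_sum, Fintype.piFinset_univ]
    simp [Finset.prod_mul_distrib, errString, kron]
  simp only [h2, Matrix.sum_apply, Matrix.smul_apply, smul_eq_mul, Matrix.mul_apply,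
    conjTranspose_apply,
    Finset.sum_mul, Finset.mul_sum, Complex.ofReal_prod]
  rw [Finset.sum_congr rfl fun x _ => Finset.sum_comm, Finset.sum_comm]
  refine Finset.sum_congr rfl fun n _ => ?_
  rw [Finset.sum_comm]
  refine Finset.sum_congr rfl fun x' _ => Finset.sum_congr rfl fun x _ => ?_
  ring

theorem treeChannel_add_smul {b : ℕ} (p : ℝ) (V : Matrix (Fin b → Fin 2) (Fin 2) ℂ) (T : ℕ)
    {ι : Type} [Fintype ι] (c : ι → ℂ) (ρ : ι → QubitOp) :
    treeChannel (xzNoise p) V T (∑ i, c i • ρ i) =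
      ∑ i, c i • treeChannel (xzNoise p) V T (ρ i) := by
  induction T with
  | zero =>
    ext y y'
    simp [treeChannel, Matrix.sum_apply]
  | succ T ih =>
    simp only [treeChannel, ih, tensorMap_xzNoise, Finset.mul_sum, Matrix.mul_sum, Matrix.sum_mul,
      Matrix.mul_smul, Matrix.smul_mul, Finset.smul_sum]
    rw [Finset.sum_comm]
    refine Finset.sum_congr rfl fun n _ => Finset.sum_congr rfl fun i _ => ?_
    rw [smul_comm]

/-! ### Propagation of errors -/

theorem IsLogical.exists_phase {b : ℕ} {V : Matrix (Fin b → Fin 2) (Fin 2) ℂ}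
    {L : XZString (Fin b)} {σ : QubitOp} (h : IsLogical V L σ) (a : ZMod 2) :
    PhaseEq (V * (if a = 0 then 1 else σ))
      (errString (fun k => a • (L.letter k).bits) * V) := by
  rcases zmod_two_cases a with rfl | rfl
  · have : errOp 0 = 1 := errOp_bits .I
    simp only [if_true, zero_smul, errString, this, kron_one, Matrix.one_mul, Matrix.mul_one]
    exact PhaseEq.refl _
  · refine ⟨L.phase, ?_, ?_⟩
    -- A fourth root of unity has modulus one.
    · have h1 : ‖L.phase‖ = 1 := by
        have := congrArg norm L.phase_pow
        rw [norm_pow, norm_one] at this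
        exact (pow_eq_one_iff_of_nonneg (norm_nonneg _) (by norm_num)).1 this
      rw [Complex.star_def, Complex.mul_conj, Complex.normSq_eq_norm_sq, h1]
      simp
    · simp only [one_ne_zero, if_false, one_smul, errString, errOp_bits]
      rw [← h, XZString.toOp, Matrix.smul_mul]
      rfl

section

variable {b : ℕ} (Lx Lz : XZString (Fin b))

/-- The errors on the children that are equivalent to an error on the parent. -/
def pushBits (e : PauliBits) (k : Fin b) : PauliBits :=
  e.1 • (Lx.letter k).bits + e.2 • (Lz.letter k).bits

/-- The errors on the next level that are equivalent to the given errors. -/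
def pushString {t : ℕ} (e : Node b t → PauliBits) (v : Node b (t + 1)) : PauliBits :=
  pushBits Lx Lz (e (Fin.init v)) (v (Fin.last t))

variable {Lx Lz} {V : Matrix (Fin b → Fin 2) (Fin 2) ℂ}

theorem encoder_mul_errOp (hLx : IsLogical V Lx pauliX) (hLz : IsLogical V Lz pauliZ)
    (e : PauliBits) :
    PhaseEq (V * errOp e) (errString (pushBits Lx Lz e) * V) := by
  have hx := (hLx.exists_phase e.1).mul_right (if e.2 = 0 then 1 else pauliZ)
  have hz := (hLz.exists_phase e.2).mul_left (errString (fun k => e.1 • (Lx.letter k).bits))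
  rw [Matrix.mul_assoc] at hx
  rw [Matrix.mul_assoc] at hx
  rw [← Matrix.mul_assoc _ _ V] at hz
  exact hx.trans (hz.trans ((errString_mul _ _).mul_right V))

theorem encoderLayer_mul_errString (hLx : IsLogical V Lx pauliX) (hLz : IsLogical V Lz pauliZ)
    {t : ℕ} (e : Node b t → PauliBits) :
    PhaseEq (encoderLayer V t * errString e)
      (errString (pushString Lx Lz e) * encoderLayer V t) := by
  choose c hc h using fun u => encoder_mul_errOp hLx hLz (e u)
  refine ⟨∏ u, c u, ?_, (kron_mul_encoderLayer fun u => ?_).symm⟩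
  · rw [star_prod, ← Finset.prod_mul_distrib]
    exact Finset.prod_eq_one fun i _ => hc i
  · rw [h u]
    simp [errString, pushString, child]

variable (Lx Lz) in
/-- The distribution of the errors at the leaves, if they are pushed through the encoders, for
a given error at the root. -/
def errKernel (p : ℝ) : (t : ℕ) → PauliBits → (Node b t → PauliBits) → ℝ
  | 0, e₀, e => if e default = e₀ then 1 else 0
  | t + 1, e₀, e' =>
    ∑ e, errKernel p t e₀ e * ∏ v, errProb p (e' v + pushString Lx Lz e v)

/-- All randomness is moved to the leaves: errors from earlier levels are pushed through the next
encoder layer and combined there with fresh noise, while the state itself is encoded without noise.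
-/
theorem treeChannel_conj_errOp (hLx : IsLogical V Lx pauliX) (hLz : IsLogical V Lz pauliZ)
    (p : ℝ) (T : ℕ) (e₀ : PauliBits) (ρ : QubitOp) :
    treeChannel (xzNoise p) V T (errOp e₀ * ρ * (errOp e₀)ᴴ) =
      ∑ e, (errKernel Lx Lz p T e₀ e : ℂ) •
        (errString e * (treeIsometry V T * ρ * (treeIsometry V T)ᴴ) * (errString e)ᴴ) := by
  induction T with
  | zero =>
    rw [Fintype.sum_eq_single (fun _ => e₀)]
    · have h1 : errString (fun _ : Node b 0 => e₀) = (errOp e₀).submatrix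
          (Equiv.funUnique (Node b 0) (Fin 2)) (Equiv.funUnique (Node b 0) (Fin 2)) := by
        ext y x
        simp [errString, kron]
      have h2 : treeIsometry V 0 = (1 : QubitOp).submatrix
          (Equiv.funUnique (Node b 0) (Fin 2)) (Equiv.refl _) := rfl
      rw [h1, h2]
      simp only [conjTranspose_submatrix]
      have h3 : (1 : QubitOp).submatrix (Equiv.funUnique (Node b 0) (Fin 2)) (Equiv.refl _) * ρ =
          ρ.submatrix (Equiv.funUnique (Node b 0) (Fin 2)) (Equiv.refl _) := by
        simpa using submatrix_mul_equiv (1 : QubitOp) ρ (Equiv.funUnique (Node b 0) (Fin 2))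
          (Equiv.refl _) (Equiv.refl _)
      rw [h3, submatrix_mul_equiv, submatrix_mul_equiv, submatrix_mul_equiv]
      simp [errKernel, treeChannel]
    · intro e he
      have : e default ≠ e₀ := fun h => he (funext fun u => by rw [← h, Unique.eq_default u])
      simp [errKernel, this]
  | succ T ih =>
    rw [treeChannel, ih, tensorMap_xzNoise]
    set σ := treeIsometry V T * ρ * (treeIsometry V T)ᴴ with hσ
    have hσ' : treeIsometry V (T + 1) * ρ * (treeIsometry V (T + 1))ᴴ =
        encoderLayer V T * σ * (encoderLayer V T)ᴴ := by
      simp only [treeIsometry, conjTranspose_mul, Matrix.mul_assoc, hσ]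
    rw [hσ']
    have h1 : ∀ (n : Node b (T + 1) → PauliBits) (e : Node b T → PauliBits),
        errString n * (encoderLayer V T * (errString e * σ * (errString e)ᴴ) *
          (encoderLayer V T)ᴴ) * (errString n)ᴴ =
        errString (n + pushString Lx Lz e) * (encoderLayer V T * σ * (encoderLayer V T)ᴴ) *
          (errString (n + pushString Lx Lz e))ᴴ := by
      intro n e
      have h := ((encoderLayer_mul_errString hLx hLz e).mul_left (errString n)).trans
        (by
          rw [← Matrix.mul_assoc]
          exact (errString_mul n (pushString Lx Lz e)).mul_right (encoderLayer V T))
      simpa only [conjTranspose_mul, Matrix.mul_assoc] using h.conj_eq σ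
    simp only [Matrix.mul_sum, Matrix.sum_mul, Matrix.mul_smul, Matrix.smul_mul, h1,
      Finset.smul_sum, smul_smul]
    rw [Finset.sum_comm]
    simp only [errKernel, Complex.ofReal_sum, Finset.sum_smul]
    rw [Finset.sum_comm (s := Finset.univ (α := Node b (T + 1) → PauliBits))]
    refine Finset.sum_congr rfl fun e _ => ?_
    -- The total error is fresh noise `n` plus the pushed error. In characteristic two, adding the
    -- pushed error again recovers `n`, which explains the argument of `errProb` in `errKernel`.
    refine Fintype.sum_equiv (Equiv.addRight (pushString Lx Lz e)) _ _ fun n => ?_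
    have h2 : ∀ f g : PauliBits, f + g + g = f := fun f g => by
      rw [add_assoc, CharTwo.add_self_eq_zero, add_zero]
    simp only [Equiv.coe_addRight, Pi.add_apply, h2]
    congr 1
    push_cast
    ring

end

/-! ### The Bhattacharyya coefficient -/

/-- The Bhattacharyya coefficient; `1 - bc P R` is the squared Hellinger distance. -/
def bc {Y : Type} [Fintype Y] (P R : Y → ℝ) : ℝ := ∑ y, √(P y * R y)

section bc

variable {Y : Type} [Fintype Y] {P R : Y → ℝ}

theorem bc_nonneg (P R : Y → ℝ) : 0 ≤ bc P R := Finset.sum_nonneg fun _ _ => Real.sqrt_nonneg _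

theorem bc_self (hP : ∀ y, 0 ≤ P y) (hP1 : ∑ y, P y = 1) : bc P P = 1 := by
  rw [← hP1, bc]
  exact Finset.sum_congr rfl fun y _ => Real.sqrt_mul_self (hP y)

theorem bc_le_one (hP : ∀ y, 0 ≤ P y) (hR : ∀ y, 0 ≤ R y) (hP1 : ∑ y, P y = 1)
    (hR1 : ∑ y, R y = 1) : bc P R ≤ 1 := by
  calc bc P R ≤ ∑ y, (P y + R y) / 2 := by
        refine Finset.sum_le_sum fun y _ => Real.sqrt_le_iff.2 ⟨?_, ?_⟩
        · linarith [hP y, hR y]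
        · nlinarith [sq_nonneg (P y - R y)]
    _ = 1 := by rw [← Finset.sum_div, Finset.sum_add_distrib, hP1, hR1]; norm_num

theorem bc_comp_equiv {Y' : Type} [Fintype Y'] (σ : Y' ≃ Y) (P R : Y → ℝ) :
    bc (fun y => P (σ y)) (fun y => R (σ y)) = bc P R :=
  σ.sum_comp fun y => √(P y * R y)

/-- Multiplicativity over independent observations is the reason for working with this coefficient
rather than with total variation. -/
theorem bc_prod {κ : Type} [Fintype κ] [DecidableEq κ] {P R : κ → Y → ℝ}
    (hP : ∀ k y, 0 ≤ P k y) (hR : ∀ k y, 0 ≤ R k y) :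
    bc (fun y : κ → Y => ∏ k, P k (y k)) (fun y => ∏ k, R k (y k)) = ∏ k, bc (P k) (R k) := by
  simp only [bc]
  rw [Finset.prod_univ_sum, Fintype.piFinset_univ]
  refine Finset.sum_congr rfl fun y _ => ?_
  rw [← Finset.prod_mul_distrib, Real.sqrt_prod _ fun k _ => mul_nonneg (hP k _) (hR k _)]

/-- Factor `|P - R| = |√P - √R| (√P + √R)` and apply Cauchy–Schwarz. The two squared sums are `2 - 2
bc` and `2 + 2 bc ≤ 4`, whence the constant `2√2`. -/
theorem sum_abs_sub_le (hP : ∀ y, 0 ≤ P y) (hR : ∀ y, 0 ≤ R y) (hP1 : ∑ y, P y = 1)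
    (hR1 : ∑ y, R y = 1) : ∑ y, |P y - R y| ≤ 2 * √2 * √(1 - bc P R) := by
  have h1 : ∀ y, |P y - R y| = |√(P y) - √(R y)| * (√(P y) + √(R y)) := fun y => by
    rw [← abs_of_nonneg (a := √(P y) + √(R y)) (by positivity), ← abs_mul]
    congr 1
    nlinarith [Real.sq_sqrt (hP y), Real.sq_sqrt (hR y)]
  have hm : ∀ y, √(P y * R y) = √(P y) * √(R y) := fun y => Real.sqrt_mul (hP y) _
  have h2 : ∑ y, |√(P y) - √(R y)| ^ 2 = 2 - 2 * bc P R := by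
    have : ∀ y, |√(P y) - √(R y)| ^ 2 = P y + R y - 2 * √(P y * R y) := fun y => by
      rw [hm, sq_abs]
      nlinarith [Real.sq_sqrt (hP y), Real.sq_sqrt (hR y)]
    simp only [this, Finset.sum_sub_distrib, Finset.sum_add_distrib, hP1, hR1, ← Finset.mul_sum, bc]
    ring
  have h3 : ∑ y, (√(P y) + √(R y)) ^ 2 = 2 + 2 * bc P R := by
    have : ∀ y, (√(P y) + √(R y)) ^ 2 = P y + R y + 2 * √(P y * R y) := fun y => by
      rw [hm]
      nlinarith [Real.sq_sqrt (hP y), Real.sq_sqrt (hR y)]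
    simp only [this, Finset.sum_add_distrib, hP1, hR1, ← Finset.mul_sum, bc]
    ring
  have hle := bc_le_one hP hR hP1 hR1
  simp only [h1]
  refine (Real.sum_mul_le_sqrt_mul_sqrt _ _ _).trans ?_
  rw [h2, h3]
  have h4 : √(2 + 2 * bc P R) ≤ 2 := Real.sqrt_le_iff.2 ⟨by norm_num, by linarith⟩
  have h5 : √(2 - 2 * bc P R) = √2 * √(1 - bc P R) := by
    rw [← Real.sqrt_mul (by norm_num)]
    ring_nf
  rw [h5]
  nlinarith [mul_nonneg (Real.sqrt_nonneg 2) (Real.sqrt_nonneg (1 - bc P R))]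

theorem sqrt_flip_ge {p a c : ℝ} (hp0 : 0 ≤ p) (hp1 : p ≤ 1) (ha : 0 ≤ a) (hc : 0 ≤ c) :
    (1 - (1 - 2 * p) ^ 2) * ((a + c) / 2) + (1 - 2 * p) ^ 2 * √(a * c) ≤
      √(((1 - p) * a + p * c) * (p * a + (1 - p) * c)) := by
  refine Real.le_sqrt_of_sq_le ?_
  have hs := Real.sq_sqrt (mul_nonneg ha hc)
  have h1 : 0 ≤ 1 - (1 - 2 * p) ^ 2 := by nlinarith
  -- With `m = (a + c)/2`, `g = √(ac)` and `θ = 1 - 2p`, the product under the root equals `(1 - θ²)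
  -- m² + θ² g²`. It exceeds the square of `(1 - θ²) m + θ² g` by this variance term `(1 - θ²) θ² (m
  -- - g)²`.
  have h2 := mul_nonneg (mul_nonneg h1 (sq_nonneg (1 - 2 * p))) (sq_nonneg ((a + c) / 2 - √(a * c)))
  have h3 : ((1 - p) * a + p * c) * (p * a + (1 - p) * c) =
      (1 - (1 - 2 * p) ^ 2) * ((a + c) / 2) ^ 2 + (1 - 2 * p) ^ 2 * √(a * c) ^ 2 := by
    rw [hs]
    ring
  rw [h3]
  linarith

/-- Strong data processing: independent bit flips contract the squared Hellinger distance. -/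
theorem one_sub_bc_flip_le {p : ℝ} (hp0 : 0 ≤ p) (hp1 : p ≤ 1) (hP : ∀ y, 0 ≤ P y)
    (hR : ∀ y, 0 ≤ R y) (hP1 : ∑ y, P y = 1) (hR1 : ∑ y, R y = 1) :
    1 - bc (fun y => (1 - p) * P y + p * R y) (fun y => p * P y + (1 - p) * R y) ≤
      (1 - 2 * p) ^ 2 * (1 - bc P R) := by
  have h := Finset.sum_le_sum fun y (_ : y ∈ Finset.univ) => sqrt_flip_ge hp0 hp1 (hP y) (hR y)
  rw [Finset.sum_add_distrib, ← Finset.mul_sum, ← Finset.mul_sum, ← Finset.sum_div,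
    Finset.sum_add_distrib, hP1, hR1] at h
  simp only [bc]
  linarith

/-- Joint concavity of the Bhattacharyya coefficient. -/
theorem sum_mul_bc_le {ι : Type} [Fintype ι] {α : ι → ℝ} (hα : ∀ i, 0 ≤ α i) {A B : ι → Y → ℝ}
    (hA : ∀ i y, 0 ≤ A i y) (hB : ∀ i y, 0 ≤ B i y) :
    ∑ i, α i * bc (A i) (B i) ≤ bc (fun y => ∑ i, α i * A i y) (fun y => ∑ i, α i * B i y) := by
  simp only [bc]
  rw [Finset.sum_congr rfl fun i _ => Finset.mul_sum _ _ (α i), Finset.sum_comm]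
  refine Finset.sum_le_sum fun y _ => ?_
  have h := Real.sum_sqrt_mul_sqrt_le Finset.univ (f := fun i => α i * A i y)
    (g := fun i => α i * B i y) (fun i => mul_nonneg (hα i) (hA i y))
    (fun i => mul_nonneg (hα i) (hB i y))
  rw [Real.sqrt_mul (Finset.sum_nonneg fun i _ => mul_nonneg (hα i) (hA i y))]
  refine le_trans (le_of_eq (Finset.sum_congr rfl fun i _ => ?_)) h
  rw [← Real.sqrt_mul (mul_nonneg (hα i) (hA i y)), mul_mul_mul_comm,
    Real.sqrt_mul (mul_self_nonneg _), Real.sqrt_mul_self (hα i)]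

end bc

theorem one_sub_prod_le_sum {κ : Type} (s : Finset κ) {x : κ → ℝ} (h0 : ∀ k, 0 ≤ x k)
    (h1 : ∀ k, x k ≤ 1) : 1 - ∏ k ∈ s, x k ≤ ∑ k ∈ s, (1 - x k) := by
  classical
  induction s using Finset.induction_on with
  | empty => simp
  | insert a s ha ih =>
    rw [Finset.prod_insert ha, Finset.sum_insert ha]
    have h2 : ∏ k ∈ s, x k ≤ 1 := Finset.prod_le_one (fun k _ => h0 k) fun k _ => h1 k
    nlinarith [h0 a, h1 a]

/-! ### Observations of the errors -/

/-- A stochastic map from the errors on a qubit to observations in `Y`. -/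
structure IsStochastic {Y : Type} [Fintype Y] (W : PauliBits → Y → ℝ) : Prop where
  nonneg : ∀ e y, 0 ≤ W e y
  sum_eq_one : ∀ e, ∑ y, W e y = 1

section

variable {Y : Type} [Fintype Y]

theorem bitProb_nonneg {p : ℝ} (hp0 : 0 ≤ p) (hp1 : p ≤ 1) (a : ZMod 2) : 0 ≤ bitProb p a := by
  unfold bitProb
  split_ifs <;> linarith

theorem sum_bitProb (p : ℝ) : ∑ a, bitProb p a = 1 := by
  simp [sum_zmod_two, bitProb]

theorem errProb_nonneg {p : ℝ} (hp0 : 0 ≤ p) (hp1 : p ≤ 1) (e : PauliBits) : 0 ≤ errProb p e :=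
  mul_nonneg (bitProb_nonneg hp0 hp1 _) (bitProb_nonneg hp0 hp1 _)

theorem sum_errProb (p : ℝ) : ∑ e, errProb p e = 1 := by
  simp only [errProb, Fintype.sum_prod_type, ← Finset.mul_sum, sum_bitProb, mul_one]

/-- The observation preceded by noise. -/
def noisyObs (p : ℝ) (W : PauliBits → Y → ℝ) (e : PauliBits) (y : Y) : ℝ :=
  ∑ n, errProb p n * W (e + n) y

theorem IsStochastic.noisyObs {p : ℝ} (hp0 : 0 ≤ p) (hp1 : p ≤ 1) {W : PauliBits → Y → ℝ}
    (hW : IsStochastic W) : IsStochastic (noisyObs p W) where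
  nonneg e y := Finset.sum_nonneg fun n _ => mul_nonneg (errProb_nonneg hp0 hp1 n) (hW.nonneg _ _)
  sum_eq_one e := by
    simp only [QuantumTree.noisyObs]
    rw [Finset.sum_comm]
    simp only [← Finset.mul_sum, hW.sum_eq_one, mul_one, sum_errProb]

/-- The error with a single bit set. -/
def unitBits : Fin 2 → PauliBits := ![(1, 0), (0, 1)]

/-- Here `c` is the noise on the other bit. It is independent of the flip between `A` and `B`, so by
joint concavity averaging over it cannot increase the distance. -/
theorem one_sub_bc_mix_flip_le {p h : ℝ} (hp0 : 0 ≤ p) (hp1 : p ≤ 1) {A B : ZMod 2 → Y → ℝ}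
    (hA : ∀ c y, 0 ≤ A c y) (hB : ∀ c y, 0 ≤ B c y) (hA1 : ∀ c, ∑ y, A c y = 1)
    (hB1 : ∀ c, ∑ y, B c y = 1) (hh : ∀ c, 1 - bc (A c) (B c) ≤ h) :
    1 - bc (fun y => ∑ c, bitProb p c * ((1 - p) * A c y + p * B c y))
      (fun y => ∑ c, bitProb p c * (p * A c y + (1 - p) * B c y)) ≤ (1 - 2 * p) ^ 2 * h := by
  have hq : 0 ≤ 1 - p := by linarith
  have h1 := sum_mul_bc_le (bitProb_nonneg hp0 hp1)
    (A := fun c y => (1 - p) * A c y + p * B c y) (B := fun c y => p * A c y + (1 - p) * B c y)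
    (fun c y => add_nonneg (mul_nonneg hq (hA c y)) (mul_nonneg hp0 (hB c y)))
    (fun c y => add_nonneg (mul_nonneg hp0 (hA c y)) (mul_nonneg hq (hB c y)))
  have h2 : ∀ c, 1 - (1 - 2 * p) ^ 2 * h ≤
      bc (fun y => (1 - p) * A c y + p * B c y) (fun y => p * A c y + (1 - p) * B c y) := fun c => by
    have := one_sub_bc_flip_le hp0 hp1 (hA c) (hB c) (hA1 c) (hB1 c)
    have := mul_le_mul_of_nonneg_left (hh c) (sq_nonneg (1 - 2 * p))
    linarith
  have h3 := Finset.sum_le_sum fun c (_ : c ∈ Finset.univ) =>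
    mul_le_mul_of_nonneg_left (h2 c) (bitProb_nonneg hp0 hp1 c)
  rw [← Finset.sum_mul, sum_bitProb, one_mul] at h3
  linarith

theorem one_sub_bc_noisyObs_le {p : ℝ} (hp0 : 0 ≤ p) (hp1 : p ≤ 1) {W : PauliBits → Y → ℝ}
    (hW : IsStochastic W) {h : ℝ} {w : Fin 2}
    (hh : ∀ e, 1 - bc (W e) (W (e + unitBits w)) ≤ h) (e : PauliBits) :
    1 - bc (noisyObs p W e) (noisyObs p W (e + unitBits w)) ≤ (1 - 2 * p) ^ 2 * h := by
  obtain ⟨i, j⟩ := e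
  have h11 : (1 : ZMod 2) + 1 = 0 := rfl
  fin_cases w
  -- For an `x` flip, the `z` noise `c` shifts the base point of the comparison; this is why `hh` is
  -- needed at every `e`.
  · have := one_sub_bc_mix_flip_le hp0 hp1 (A := fun c => W ((i, j) + (0, c)))
      (B := fun c => W ((i, j) + (0, c) + (1, 0))) (fun c y => hW.nonneg _ _)
      (fun c y => hW.nonneg _ _) (fun c => hW.sum_eq_one _) (fun c => hW.sum_eq_one _)
      (fun c => hh _)
    convert this using 3 <;> funext y <;>
    simp only [noisyObs, Fintype.sum_prod_type, sum_zmod_two, errProb, bitProb, unitBits,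
      Fin.zero_eta, cons_val_zero, Prod.mk_add_mk, add_zero, if_true, one_ne_zero, if_false,
      add_assoc, h11] <;> ring
  · have := one_sub_bc_mix_flip_le hp0 hp1 (A := fun c => W ((i, j) + (c, 0)))
      (B := fun c => W ((i, j) + (c, 0) + (0, 1))) (fun c y => hW.nonneg _ _)
      (fun c y => hW.nonneg _ _) (fun c => hW.sum_eq_one _) (fun c => hW.sum_eq_one _)
      (fun c => hh _)
    convert this using 3 <;> funext y <;>
    simp only [noisyObs, Fintype.sum_prod_type, sum_zmod_two, errProb, bitProb, unitBits,
      Fin.mk_one, cons_val_one, cons_val_fin_one, Prod.mk_add_mk, add_zero, if_true, one_ne_zero,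
      if_false, add_assoc, h11] <;> ring

variable {b : ℕ} (Lx Lz : XZString (Fin b))

/-- The observation of the errors on the children, as an observation of the error on the parent. -/
def childObs (p : ℝ) (W : PauliBits → Y → ℝ) (e : PauliBits) (y : Fin b → Y) : ℝ :=
  ∏ k, noisyObs p W (pushBits Lx Lz e k) (y k)

theorem IsStochastic.childObs {p : ℝ} (hp0 : 0 ≤ p) (hp1 : p ≤ 1) {W : PauliBits → Y → ℝ}
    (hW : IsStochastic W) : IsStochastic (childObs Lx Lz p W) where
  nonneg e y := Finset.prod_nonneg fun k _ => (hW.noisyObs hp0 hp1).nonneg _ _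
  sum_eq_one e := by
    have := Finset.prod_univ_sum (fun _ : Fin b => (Finset.univ : Finset Y))
      (fun k y => QuantumTree.noisyObs p W (pushBits Lx Lz e k) y)
    rw [Fintype.piFinset_univ] at this
    simp only [QuantumTree.childObs]
    rw [← this]
    exact Finset.prod_eq_one fun k _ => (hW.noisyObs hp0 hp1).sum_eq_one _

theorem pushBits_add_unitBits (e : PauliBits) (w : Fin 2) (k : Fin b) :
    pushBits Lx Lz (e + unitBits w) k =
      pushBits Lx Lz e k + ((![Lx, Lz] w).letter k).bits := by
  fin_cases w <;> simp [pushBits, unitBits, add_smul] <;> abel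

theorem sum_letter {ι R : Type} [Fintype ι] [CommSemiring R] (L : XZString ι) {f : Letter → R}
    (hf : f .I = 0) :
    ∑ k, f (L.letter k) = f .X * L.count .X + f .Z * L.count .Z := by
  have : ∀ a : Letter, f a = f .X * (if a = .X then 1 else 0) + f .Z * (if a = .Z then 1 else 0) :=
    fun a => by cases a <;> simp [hf]
  rw [Finset.sum_congr rfl fun k _ => this (L.letter k), Finset.sum_add_distrib, ← Finset.mul_sum,
    ← Finset.mul_sum]
  simp [XZString.count]

/-- The weight transition matrix with real entries. -/
def realWeightMatrix : Matrix (Fin 2) (Fin 2) ℝ := (weightMatrix Lx Lz).map Nat.cast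

/-- A child notices a flip of bit `w` only where `L_w` acts, and there it sees a flip of a single
bit, because no letter is `σ_y`. Subadditivity over children turns the letter counts of `L_w` into
column `w` of the matrix. -/
theorem one_sub_bc_childObs_le {p : ℝ} (hp0 : 0 ≤ p) (hp1 : p ≤ 1) {W : PauliBits → Y → ℝ}
    (hW : IsStochastic W) {h : Fin 2 → ℝ}
    (hh : ∀ w e, 1 - bc (W e) (W (e + unitBits w)) ≤ h w) (w : Fin 2) (e : PauliBits) :
    1 - bc (childObs Lx Lz p W e) (childObs Lx Lz p W (e + unitBits w)) ≤
      (((1 - 2 * p) ^ 2) • (h ᵥ* realWeightMatrix Lx Lz)) w := by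
  have hN := hW.noisyObs hp0 hp1
  have hbc : bc (childObs Lx Lz p W e) (childObs Lx Lz p W (e + unitBits w)) =
      ∏ k, bc (noisyObs p W (pushBits Lx Lz e k))
        (noisyObs p W (pushBits Lx Lz (e + unitBits w) k)) :=
    bc_prod (fun k => hN.nonneg _) (fun k => hN.nonneg _)
  rw [hbc]
  refine (one_sub_prod_le_sum _ (fun k => bc_nonneg _ _) fun k =>
    bc_le_one (hN.nonneg _) (hN.nonneg _) (hN.sum_eq_one _) (hN.sum_eq_one _)).trans ?_
  let f : Letter → ℝ
    | .I => 0
    | .X => (1 - 2 * p) ^ 2 * h 0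
    | .Z => (1 - 2 * p) ^ 2 * h 1
  have hf : ∀ k, 1 - bc (noisyObs p W (pushBits Lx Lz e k))
      (noisyObs p W (pushBits Lx Lz (e + unitBits w) k)) ≤ f ((![Lx, Lz] w).letter k) := by
    intro k
    rw [pushBits_add_unitBits]
    cases (![Lx, Lz] w).letter k
    · simp [Letter.bits, f, bc_self (hN.nonneg _) (hN.sum_eq_one _)]
    · exact one_sub_bc_noisyObs_le hp0 hp1 hW (w := 0) (hh 0) _
    · exact one_sub_bc_noisyObs_le hp0 hp1 hW (w := 1) (hh 1) _
  refine (Finset.sum_le_sum fun k _ => hf k).trans (le_of_eq ?_)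
  rw [sum_letter _ rfl]
  fin_cases w <;>
  simp [f, vecMul, dotProduct, Fin.sum_univ_two, realWeightMatrix, weightMatrix] <;> ring

/-- The joint observation of the errors on all leaves. -/
def treeObs (p : ℝ) (T : ℕ) (W : PauliBits → Y → ℝ) (e₀ : PauliBits) (y : Node b T → Y) : ℝ :=
  ∑ e, errKernel Lx Lz p T e₀ e * ∏ u, W (e u) (y u)

theorem treeObs_zero {Y : Type} (p : ℝ) (W : PauliBits → Y → ℝ) (e₀ : PauliBits)
    (y : Node b 0 → Y) :
    treeObs Lx Lz p 0 W e₀ y = W e₀ (Equiv.funUnique (Node b 0) Y y) := by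
  rw [treeObs, Fintype.sum_eq_single (fun _ => e₀)]
  · simp [errKernel]
  · intro e he
    have : e default ≠ e₀ := fun h => he (funext fun u => by rw [← h, Unique.eq_default u])
    simp [errKernel, this]

/-- Given the errors on level `T`, the groups of siblings on the last level are independent, so that
level can be absorbed into the observation. The alphabet changes from `Y` to `Fin b → Y`, hence the
inductions on `T` quantify over `Y`. -/
theorem treeObs_succ {Y : Type} (p : ℝ) (T : ℕ) (W : PauliBits → Y → ℝ) (e₀ : PauliBits)
    (y : Node b (T + 1) → Y) :
    treeObs Lx Lz p (T + 1) W e₀ y =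
      treeObs Lx Lz p T (childObs Lx Lz p W) e₀ (groupEquiv b T Y y) := by
  simp only [treeObs, errKernel, Finset.sum_mul]
  rw [Finset.sum_comm]
  refine Finset.sum_congr rfl fun e _ => ?_
  simp only [mul_assoc, ← Finset.mul_sum, ← Finset.prod_mul_distrib]
  congr 1
  have h := Finset.prod_univ_sum (fun _ : Node b (T + 1) => (Finset.univ : Finset PauliBits))
    (fun v n => errProb p (n + pushString Lx Lz e v) * W n (y v))
  rw [Fintype.piFinset_univ] at h
  rw [← h, prod_node_succ]
  refine Finset.prod_congr rfl fun u _ => Finset.prod_congr rfl fun k _ => ?_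
  have hpush : pushString Lx Lz e (child u k) = pushBits Lx Lz (e u) k := by
    simp [pushString, child]
  rw [hpush, noisyObs, groupEquiv_apply]
  refine Fintype.sum_equiv (Equiv.addRight (pushBits Lx Lz (e u) k)) _ _ fun n => ?_
  rw [Equiv.coe_addRight, add_left_comm, CharTwo.add_self_eq_zero, add_zero]

theorem IsStochastic.treeObs {p : ℝ} (hp0 : 0 ≤ p) (hp1 : p ≤ 1) (T : ℕ) :
    ∀ {Y : Type} [Fintype Y] {W : PauliBits → Y → ℝ}, IsStochastic W → ∀ e₀,
      (∀ y, 0 ≤ treeObs Lx Lz p T W e₀ y) ∧ ∑ y, treeObs Lx Lz p T W e₀ y = 1 := by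
  induction T with
  | zero =>
    intro Y _ W hW e₀
    simp only [treeObs_zero]
    refine ⟨fun y => hW.nonneg _ _, ?_⟩
    rw [(Equiv.funUnique (Node b 0) Y).sum_comp (fun y => W e₀ y), hW.sum_eq_one]
  | succ T ih =>
    intro Y _ W hW e₀
    have h := ih (hW.childObs Lx Lz hp0 hp1) e₀
    simp only [treeObs_succ]
    refine ⟨fun y => h.1 _, ?_⟩
    rw [(groupEquiv b T Y).sum_comp
      (fun y => QuantumTree.treeObs Lx Lz p T (QuantumTree.childObs Lx Lz p W) e₀ y), h.2]

theorem one_sub_bc_treeObs_le {p : ℝ} (hp0 : 0 ≤ p) (hp1 : p ≤ 1) (T : ℕ) :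
    ∀ {Y : Type} [Fintype Y] {W : PauliBits → Y → ℝ}, IsStochastic W → ∀ {h : Fin 2 → ℝ},
      (∀ w e, 1 - bc (W e) (W (e + unitBits w)) ≤ h w) → ∀ w e₀,
      1 - bc (treeObs Lx Lz p T W e₀) (treeObs Lx Lz p T W (e₀ + unitBits w)) ≤
        ((1 - 2 * p) ^ 2) ^ T * (h ᵥ* realWeightMatrix Lx Lz ^ T) w := by
  induction T with
  | zero =>
    intro Y _ W hW h hh w e₀
    have h1 : ∀ e, treeObs Lx Lz p 0 W e = fun y => W e (Equiv.funUnique (Node b 0) Y y) :=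
      fun e => funext fun y => treeObs_zero Lx Lz p W e y
    rw [h1, h1, bc_comp_equiv]
    simpa using hh w e₀
  | succ T ih =>
    intro Y _ W hW h hh w e₀
    have h1 : ∀ e, treeObs Lx Lz p (T + 1) W e =
        fun y => treeObs Lx Lz p T (childObs Lx Lz p W) e (groupEquiv b T Y y) :=
      fun e => funext fun y => treeObs_succ Lx Lz p T W e y
    rw [h1, h1, bc_comp_equiv]
    refine (ih (hW.childObs Lx Lz hp0 hp1) (one_sub_bc_childObs_le Lx Lz hp0 hp1 hW hh)
      w e₀).trans (le_of_eq ?_)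
    rw [smul_vecMul, vecMul_vecMul, ← pow_succ', Pi.smul_apply, smul_eq_mul]
    ring

theorem errKernel_eq_treeObs (p : ℝ) (T : ℕ) (e₀ : PauliBits) :
    errKernel Lx Lz p T e₀ = treeObs Lx Lz p T (fun e y => if e = y then 1 else 0) e₀ := by
  funext y
  rw [treeObs, Fintype.sum_eq_single y]
  · simp
  · intro e he
    obtain ⟨u, hu⟩ := Function.ne_iff.1 he
    rw [Finset.prod_eq_zero (Finset.mem_univ u) (by simp [hu]), mul_zero]

theorem sum_abs_errKernel_sub_le {p : ℝ} (hp0 : 0 ≤ p) (hp1 : p ≤ 1) (T : ℕ) (w : Fin 2)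
    (e₀ : PauliBits) :
    ∑ e, |errKernel Lx Lz p T e₀ e - errKernel Lx Lz p T (e₀ + unitBits w) e| ≤
      2 * √2 * (√((1 ᵥ* realWeightMatrix Lx Lz ^ T) w) * |1 - 2 * p| ^ T) := by
  have hW : IsStochastic (fun e y : PauliBits => if e = y then (1 : ℝ) else 0) :=
    ⟨fun e y => by split_ifs <;> norm_num, fun e => by simp⟩
  have hs := hW.treeObs Lx Lz hp0 hp1 T
  simp only [errKernel_eq_treeObs]
  refine (sum_abs_sub_le (hs _).1 (hs _).1 (hs _).2 (hs _).2).trans ?_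
  refine mul_le_mul_of_nonneg_left ?_ (by positivity)
  -- The recursion starts from exact observation of the leaf errors, with the trivial bound `1 - bc
  -- ≤ 1` for both flips; this is the row vector `(1,1)`.
  have h := one_sub_bc_treeObs_le Lx Lz hp0 hp1 T hW (h := 1)
    (fun w e => by simpa using bc_nonneg _ _) w e₀
  refine (Real.sqrt_le_sqrt h).trans (le_of_eq ?_)
  rw [Real.sqrt_mul (by positivity), mul_comm, ← pow_mul, mul_comm 2 T, pow_mul,
    Real.sqrt_sq_eq_abs, abs_pow]

end

/-! ### The growth of the weights -/

theorem XZString.weight_eq {ι : Type} [Fintype ι] (L : XZString ι) :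
    L.weight = L.count .X + L.count .Z := by
  classical
  rw [weight, count, count, ← Finset.card_union_of_disjoint]
  · congr 1
    ext i
    cases h : L.letter i <;> simp [h]
  · refine Finset.disjoint_filter.2 fun i _ h => by simp [h]

section

variable {b : ℕ} (Lx Lz : XZString (Fin b))

theorem gxz_eq (T : ℕ) : gxz Lx Lz T =
    max ((1 ᵥ* weightMatrix Lx Lz ^ T) 0) ((1 ᵥ* weightMatrix Lx Lz ^ T) 1) := by
  simp [gxz, dotProduct, vecMul, mulVec, Fin.sum_univ_two]

theorem one_vecMul_pow_succ (T : ℕ) (w : Fin 2) : (1 ᵥ* weightMatrix Lx Lz ^ (T + 1)) w =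
    (1 ᵥ* weightMatrix Lx Lz ^ T) 0 * (![Lx, Lz] w).count .X +
      (1 ᵥ* weightMatrix Lx Lz ^ T) 1 * (![Lx, Lz] w).count .Z := by
  rw [pow_succ, ← vecMul_vecMul]
  fin_cases w <;>
  simp [vecMul, dotProduct, Fin.sum_univ_two, weightMatrix]

theorem one_vecMul_realWeightMatrix_pow (T : ℕ) (w : Fin 2) :
    (1 ᵥ* realWeightMatrix Lx Lz ^ T) w = ((1 ᵥ* weightMatrix Lx Lz ^ T) w : ℕ) := by
  have h := RingHom.map_vecMul (Nat.castRingHom ℝ) (weightMatrix Lx Lz ^ T) 1 w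
  rw [Matrix.map_pow] at h
  rw [← Nat.coe_castRingHom, h]
  congr 2
  funext i
  simp

theorem one_vecMul_realWeightMatrix_pow_le (T : ℕ) (w : Fin 2) :
    (1 ᵥ* realWeightMatrix Lx Lz ^ T) w ≤ gxz Lx Lz T := by
  rw [one_vecMul_realWeightMatrix_pow, gxz_eq]
  fin_cases w
  · exact Nat.cast_le.2 (le_max_left _ _)
  · exact Nat.cast_le.2 (le_max_right _ _)

/-- Column `w` of `D` sums to the weight of `L_w`, so one more factor of `D` multiplies the largest
column sum by at most `bMax`. -/
theorem gxz_le_bMax_pow (T : ℕ) : gxz Lx Lz T ≤ bMax Lx Lz ^ T := by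
  have h : ∀ w, (1 ᵥ* weightMatrix Lx Lz ^ T) w ≤ bMax Lx Lz ^ T := by
    induction T with
    | zero => simp
    | succ T ih =>
      intro w
      have hw : (![Lx, Lz] w).count .X + (![Lx, Lz] w).count .Z ≤ bMax Lx Lz := by
        rw [← XZString.weight_eq]
        fin_cases w
        · exact le_max_left _ _
        · exact le_max_right _ _
      rw [one_vecMul_pow_succ, pow_succ]
      calc _ ≤ bMax Lx Lz ^ T * (![Lx, Lz] w).count .X + bMax Lx Lz ^ T * (![Lx, Lz] w).count .Z :=
            add_le_add (Nat.mul_le_mul_right _ (ih 0)) (Nat.mul_le_mul_right _ (ih 1))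
        _ ≤ _ := by
            rw [← mul_add]
            exact Nat.mul_le_mul_left _ hw
  rw [gxz_eq]
  exact max_le (h 0) (h 1)

/-! ### Concatenated logical operators -/

theorem sum_node_succ {t : ℕ} {R : Type} [AddCommMonoid R] (f : Node b (t + 1) → R) :
    ∑ v, f v = ∑ u : Node b t, ∑ k, f (child u k) := by
  rw [← (childEquiv b t).sum_comp, Fintype.sum_prod_type]
  rfl

theorem concatLogical_succ_letter (w : Letter) {t : ℕ} (u : Node b t) (k : Fin b) :
    (concatLogical Lx Lz w (t + 1)).letter (child u k) =
      (substitute Lx Lz ((concatLogical Lx Lz w t).letter u)).letter k := by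
  simp [concatLogical, child]

theorem count_concatLogical_succ (w a : Letter) (ha : a ≠ .I) (t : ℕ) :
    (concatLogical Lx Lz w (t + 1)).count a =
      Lx.count a * (concatLogical Lx Lz w t).count .X +
        Lz.count a * (concatLogical Lx Lz w t).count .Z := by
  have h := sum_letter (concatLogical Lx Lz w t)
    (f := fun c => (substitute Lx Lz c).count a) (by
      simp only [substitute, XZString.count, Finset.card_eq_zero]
      exact Finset.filter_false_of_mem fun _ _ h => ha h.symm)
  refine Eq.trans ?_ h
  simp only [XZString.count, Finset.card_filter, sum_node_succ, concatLogical_succ_letter]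

/-- Substitution acts linearly on letter counts through `D`, so the weight of `L_w[T]` is exactly
`(1,1) D^T e_w`. -/
theorem count_concatLogical (w : Fin 2) (T : ℕ) :
    ![(concatLogical Lx Lz (![.X, .Z] w) T).count .X,
      (concatLogical Lx Lz (![.X, .Z] w) T).count .Z] =
      weightMatrix Lx Lz ^ T *ᵥ Pi.single w 1 := by
  induction T with
  | zero =>
    fin_cases w <;> ext i <;> fin_cases i <;> simp [concatLogical, XZString.count]
  | succ T ih =>
    rw [pow_succ', ← mulVec_mulVec, ← ih, count_concatLogical_succ _ _ _ _ (by simp),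
      count_concatLogical_succ _ _ _ _ (by simp)]
    ext i
    fin_cases i <;> simp [weightMatrix, mulVec, dotProduct, Fin.sum_univ_two]

theorem weight_concatLogical_le (w : Fin 2) (T : ℕ) :
    (concatLogical Lx Lz (![.X, .Z] w) T).weight ≤ gxz Lx Lz T := by
  have h0 := congrFun (count_concatLogical Lx Lz w T) 0
  have h1 := congrFun (count_concatLogical Lx Lz w T) 1
  simp only [cons_val_zero, cons_val_one, mulVec_single_one, col_apply, cons_val_fin_one] at h0 h1
  rw [XZString.weight_eq, h0, h1, gxz_eq]
  have : (1 ᵥ* weightMatrix Lx Lz ^ T) w =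
      (weightMatrix Lx Lz ^ T) 0 w + (weightMatrix Lx Lz ^ T) 1 w := by
    simp [vecMul, dotProduct, Fin.sum_univ_two]
  rw [← this]
  fin_cases w
  · exact le_max_left _ _
  · exact le_max_right _ _

variable {Lx Lz} {V : Matrix (Fin b → Fin 2) (Fin 2) ℂ}

theorem toOp_eq_smul_kron {ι : Type} [Fintype ι] (L : XZString ι) :
    L.toOp = L.phase • kron fun i => (L.letter i).toOp := rfl

theorem isLogical_substitute (hLx : IsLogical V Lx pauliX) (hLz : IsLogical V Lz pauliZ)
    (a : Letter) : IsLogical V (substitute Lx Lz a) a.toOp := by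
  cases a
  · simp only [IsLogical, toOp_eq_smul_kron, substitute, Letter.toOp, kron_one, one_smul,
      Matrix.one_mul, Matrix.mul_one]
  · exact hLx
  · exact hLz

theorem isLogical_concatLogical (hLx : IsLogical V Lx pauliX) (hLz : IsLogical V Lz pauliZ)
    (w : Letter) (T : ℕ) : IsLogical (treeIsometry V T) (concatLogical Lx Lz w T) w.toOp := by
  induction T with
  | zero =>
    have h1 : (concatLogical Lx Lz w 0).toOp = w.toOp.submatrix
        (Equiv.funUnique (Node b 0) (Fin 2)) (Equiv.funUnique (Node b 0) (Fin 2)) := by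
      ext y x
      simp [toOp_eq_smul_kron, kron, concatLogical]
    have h2 : treeIsometry V 0 = (1 : QubitOp).submatrix
        (Equiv.funUnique (Node b 0) (Fin 2)) (Equiv.refl _) := rfl
    rw [IsLogical, h1, h2, submatrix_mul_equiv, Matrix.mul_one]
    simpa using (submatrix_mul_equiv (1 : QubitOp) w.toOp (Equiv.funUnique (Node b 0) (Fin 2))
      (Equiv.refl _) (Equiv.refl _)).symm
  | succ T ih =>
    have h := kron_mul_encoderLayer (V := V) (t := T)
      (M := fun v => ((concatLogical Lx Lz w (T + 1)).letter v).toOp)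
      (S := fun u => ((concatLogical Lx Lz w T).letter u).toOp)
      (c := fun u => (substitute Lx Lz ((concatLogical Lx Lz w T).letter u)).phase) (fun u => by
        simp only [concatLogical_succ_letter]
        rw [← isLogical_substitute hLx hLz, toOp_eq_smul_kron, Matrix.smul_mul])
    have hs : (concatLogical Lx Lz w (T + 1)).toOp * encoderLayer V T =
        encoderLayer V T * (concatLogical Lx Lz w T).toOp := by
      rw [toOp_eq_smul_kron, toOp_eq_smul_kron, Matrix.mul_smul, ← h, smul_smul, Matrix.smul_mul]
      rfl
    rw [IsLogical, treeIsometry, ← Matrix.mul_assoc, hs, Matrix.mul_assoc, ih, Matrix.mul_assoc]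

/-! ### The bound on the trace distance -/

/-- The Pauli average kills the off-diagonal entries and equalises the diagonal ones. Writing `I/2`
through `ρ` itself lets both outputs be expanded in the same states. -/
theorem sum_conj_errOp {ρ : QubitOp} (hρ : ρ.trace = 1) :
    (1 / 2 : ℂ) • (1 : QubitOp) =
      ∑ e₀ : PauliBits, (1 / 4 : ℂ) • (errOp e₀ * ρ * (errOp e₀)ᴴ) := by
  have hd : ρ 1 1 = 1 - ρ 0 0 := by
    rw [← hρ, trace_fin_two]
    ring
  simp only [Fintype.sum_prod_type, sum_zmod_two, errOp, if_true, one_ne_zero, if_false,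
    Matrix.one_mul, Matrix.mul_one, conjTranspose_mul, conjTranspose_one, pauliX_conjTranspose,
    pauliZ_conjTranspose]
  rw [eta_fin_two ρ, hd]
  ext i j
  fin_cases i <;> fin_cases j <;> simp [pauliX, pauliZ] <;> ring

variable (Lx Lz) in
/-- The signed measure on the errors that represents the difference between the outputs for a
given input and for the maximally mixed input. -/
def errDeviation (p : ℝ) (T : ℕ) (e : Node b T → PauliBits) : ℝ :=
  errKernel Lx Lz p T 0 e - ∑ e₀, 1 / 4 * errKernel Lx Lz p T e₀ e

theorem treeChannel_sub_eq (hLx : IsLogical V Lx pauliX) (hLz : IsLogical V Lz pauliZ)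
    (p : ℝ) (T : ℕ) {ρ : QubitOp} (hρ : ρ.trace = 1) :
    treeChannel (xzNoise p) V T ρ
        - treeChannel (xzNoise p) V T ((1 / 2 : ℂ) • (1 : QubitOp)) =
      ∑ e, (errDeviation Lx Lz p T e : ℂ) •
        (errString e * (treeIsometry V T * ρ * (treeIsometry V T)ᴴ) * (errString e)ᴴ) := by
  have h0 : errOp 0 * ρ * (errOp 0)ᴴ = ρ := by
    have : errOp 0 = 1 := errOp_bits .I
    simp [this]
  conv_lhs => rw [sum_conj_errOp hρ, treeChannel_add_smul]
  conv_lhs => arg 1; rw [← h0]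
  simp only [treeChannel_conj_errOp hLx hLz, Finset.smul_sum, smul_smul]
  rw [Finset.sum_comm, ← Finset.sum_sub_distrib]
  refine Finset.sum_congr rfl fun e _ => ?_
  rw [← Finset.sum_smul, ← sub_smul, errDeviation]
  congr 1
  push_cast
  rfl

theorem sum_abs_errDeviation_le {p : ℝ} (hp0 : 0 ≤ p) (hp1 : p ≤ 1) (T : ℕ) :
    ∑ e, |errDeviation Lx Lz p T e| ≤ 2 * √2 * √(gxz Lx Lz T : ℝ) * |1 - 2 * p| ^ T := by
  set Q := errKernel Lx Lz p T
  have hle : ∀ w e₀, ∑ e, |Q e₀ e - Q (e₀ + unitBits w) e| ≤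
      2 * √2 * √(gxz Lx Lz T : ℝ) * |1 - 2 * p| ^ T := fun w e₀ => by
    refine (sum_abs_errKernel_sub_le Lx Lz hp0 hp1 T w e₀).trans ?_
    rw [← mul_assoc]
    gcongr
    exact one_vecMul_realWeightMatrix_pow_le Lx Lz T w
  have hx := hle 0 0
  have hz := hle 1 0
  have hxz := hle 1 (0 + unitBits 0)
  have h : ∀ e, |errDeviation Lx Lz p T e| ≤ 1 / 4 * (2 * |Q 0 e - Q (0 + unitBits 0) e| +
      |Q 0 e - Q (0 + unitBits 1) e| +
      |Q (0 + unitBits 0) e - Q (0 + unitBits 0 + unitBits 1) e|) := fun e => by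
    -- Only single-bit flips are controlled, so the root errors `x`, `z` and `xz` are reached from
    -- `0` by the paths `0 → x → xz` and `0 → z`. The coefficients `2 + 1 + 1` cancel the factor
    -- `1/4`.
    have hd : errDeviation Lx Lz p T e = 1 / 4 * (2 * (Q 0 e - Q (0 + unitBits 0) e) +
        (Q 0 e - Q (0 + unitBits 1) e) +
        (Q (0 + unitBits 0) e - Q (0 + unitBits 0 + unitBits 1) e)) := by
      have h0 : (0 : PauliBits) = (0, 0) := rfl
      simp only [errDeviation, Fintype.sum_prod_type, sum_zmod_two, unitBits, cons_val_zero,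
        cons_val_one, cons_val_fin_one, zero_add, Prod.mk_add_mk, add_zero, Q, h0]
      ring
    rw [hd, abs_mul, abs_of_pos (by norm_num : (0 : ℝ) < 1 / 4)]
    refine mul_le_mul_of_nonneg_left ?_ (by norm_num)
    refine (abs_add_three _ _ _).trans ?_
    rw [abs_mul, abs_two]
  refine (Finset.sum_le_sum fun e _ => h e).trans ?_
  rw [← Finset.mul_sum, Finset.sum_add_distrib, Finset.sum_add_distrib, ← Finset.mul_sum]
  linarith

theorem isDensity_output {T : ℕ} (hV : Vᴴ * V = 1) {ρ : QubitOp} (hρ : IsDensity ρ)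
    (e : Node b T → PauliBits) : IsDensity
      (errString e * (treeIsometry V T * ρ * (treeIsometry V T)ᴴ) * (errString e)ᴴ) :=
  (hρ.conj (treeIsometry_isometry hV T)).conj (errString_isometry e)

theorem traceNorm_treeChannel_sub_le (hV : Vᴴ * V = 1) (hLx : IsLogical V Lx pauliX)
    (hLz : IsLogical V Lz pauliZ) {p : ℝ} (hp0 : 0 ≤ p) (hp1 : p ≤ 1) (T : ℕ) {ρ : QubitOp}
    (hρ : IsDensity ρ) :
    traceNorm (treeChannel (xzNoise p) V T ρ
        - treeChannel (xzNoise p) V T ((1 / 2 : ℂ) • (1 : QubitOp))) ≤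
      2 * √2 * √(gxz Lx Lz T : ℝ) * |1 - 2 * p| ^ T := by
  rw [treeChannel_sub_eq hLx hLz p T hρ.2]
  exact (traceNorm_sum_smul_le _ _ (isDensity_output hV hρ)).trans
    (sum_abs_errDeviation_le hp0 hp1 T)

theorem traceNorm_treeChannel_sub_le_two_mul (hV : Vᴴ * V = 1) (hLx : IsLogical V Lx pauliX)
    (hLz : IsLogical V Lz pauliZ) {p : ℝ} (hp0 : 0 ≤ p) (hp1 : p ≤ 1) (T : ℕ) {ρ ρ' : QubitOp}
    (hρ : IsDensity ρ) (hρ' : IsDensity ρ') :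
    traceNorm (treeChannel (xzNoise p) V T ρ - treeChannel (xzNoise p) V T ρ') ≤
      2 * (2 * √2 * √(gxz Lx Lz T : ℝ) * |1 - 2 * p| ^ T) := by
  rw [← sub_sub_sub_cancel_right _ _
      (treeChannel (xzNoise p) V T ((1 / 2 : ℂ) • (1 : QubitOp))),
    treeChannel_sub_eq hLx hLz p T hρ.2, treeChannel_sub_eq hLx hLz p T hρ'.2]
  -- The maximally mixed outputs cancel, and the two deviations, taken with opposite signs, form one
  -- real combination of density operators over two copies of the index set.
  have h := traceNorm_sum_smul_le (Sum.elim (errDeviation Lx Lz p T) (-errDeviation Lx Lz p T))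
    (Sum.elim _ _) (Sum.rec (isDensity_output hV hρ) (isDensity_output hV hρ'))
  simp only [Fintype.sum_sum_type, Sum.elim_inl, Sum.elim_inr, Pi.neg_apply, abs_neg,
    Complex.ofReal_neg, neg_smul, Finset.sum_neg_distrib, ← sub_eq_add_neg] at h
  refine h.trans ?_
  have := sum_abs_errDeviation_le (Lx := Lx) (Lz := Lz) hp0 hp1 T
  linarith

/-! ### The threshold -/

open Filter Topology

theorem outputBecomesIndependent_of_tendsto (hV : Vᴴ * V = 1) (hLx : IsLogical V Lx pauliX)
    (hLz : IsLogical V Lz pauliZ) {p : ℝ} (hp0 : 0 ≤ p) (hp1 : p ≤ 1)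
    (h : Tendsto (fun T : ℕ => (gxz Lx Lz T : ℝ) * ((1 - 2 * p) ^ 2) ^ T) atTop (𝓝 0)) :
    OutputBecomesIndependent (xzNoise p) V := by
  intro ε hε
  have h1 : Tendsto (fun T : ℕ => 2 * (2 * √2 * √((gxz Lx Lz T : ℝ) * ((1 - 2 * p) ^ 2) ^ T)))
      atTop (𝓝 0) := by
    simpa using ((h.sqrt.const_mul (2 * √2)).const_mul 2)
  obtain ⟨T₀, hT₀⟩ := eventually_atTop.1 (h1.eventually_lt_const hε)
  refine ⟨T₀, fun T hT ρ ρ' hρ hρ' => lt_of_le_of_lt ?_ (hT₀ T hT)⟩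
  refine (traceNorm_treeChannel_sub_le_two_mul hV hLx hLz hp0 hp1 T hρ hρ').trans (le_of_eq ?_)
  rw [Real.sqrt_mul (Nat.cast_nonneg _), ← pow_mul, mul_comm 2 T, pow_mul, Real.sqrt_sq_eq_abs,
    abs_pow]
  ring

section Gelfand

attribute [local instance] Matrix.linftyOpNormedRing Matrix.linftyOpNormedAlgebra

/-- Gelfand's formula bounds the row-sum norm of `A ^ n` by `r ^ n` for large `n`, and this norm
dominates every entry. -/
theorem exists_entry_le_pow (A : Matrix (Fin 2) (Fin 2) ℂ) {r : ℝ} (hr0 : 0 < r)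
    (hr : (spectralRadius ℂ A).toReal < r) : ∀ᶠ n : ℕ in atTop, ∀ i j, ‖(A ^ n) i j‖ ≤ r ^ n := by
  have hlt : spectralRadius ℂ A < ENNReal.ofReal r :=
    (ENNReal.lt_ofReal_iff_toReal_lt
      (ne_top_of_le_ne_top ENNReal.coe_ne_top (spectrum.spectralRadius_le_nnnorm A))).2 hr
  have h := (spectrum.pow_norm_pow_one_div_tendsto_nhds_spectralRadius A).eventually_lt_const hlt
  filter_upwards [h, eventually_ge_atTop 1] with n hn hn1 i j
  have hn0 : (n : ℝ) ≠ 0 := by positivity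
  have h1 : ‖A ^ n‖ ^ (1 / n : ℝ) < r := (ENNReal.ofReal_lt_ofReal_iff hr0).1 hn
  have h2 : ‖A ^ n‖ ≤ r ^ n := by
    have := pow_le_pow_left₀ (Real.rpow_nonneg (norm_nonneg _) _) h1.le n
    rwa [← Real.rpow_natCast (‖A ^ n‖ ^ (1 / n : ℝ)), ← Real.rpow_mul (norm_nonneg _),
      one_div_mul_cancel hn0, Real.rpow_one] at this
  refine le_trans ?_ h2
  rw [← coe_nnnorm, ← coe_nnnorm, NNReal.coe_le_coe, linfty_opNNNorm_def]
  exact (Finset.single_le_sum (f := fun j => ‖(A ^ n) i j‖₊) (fun _ _ => zero_le)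
    (Finset.mem_univ j)).trans (Finset.le_sup (f := fun i => ∑ j, ‖(A ^ n) i j‖₊)
      (Finset.mem_univ i))

end Gelfand

variable (Lx Lz) in
theorem eventually_gxz_le {r : ℝ} (hr0 : 0 < r) (hr : lambdaMax Lx Lz < r) :
    ∀ᶠ T : ℕ in atTop, (gxz Lx Lz T : ℝ) ≤ 2 * r ^ T := by
  filter_upwards [exists_entry_le_pow _ hr0 hr] with T hT
  have hentry : ∀ i j, ((weightMatrix Lx Lz ^ T) i j : ℝ) ≤ r ^ T := fun i j => by
    have h := hT i j
    have hmap := Matrix.map_pow (weightMatrix Lx Lz) (Nat.castRingHom ℂ) T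
    rw [Nat.coe_castRingHom] at hmap
    rw [← hmap, map_apply, Complex.norm_natCast] at h
    exact h
  have hcol : ∀ w, (((1 ᵥ* weightMatrix Lx Lz ^ T) w : ℕ) : ℝ) ≤ 2 * r ^ T := fun w => by
    simp only [vecMul, dotProduct, Fin.sum_univ_two, Pi.one_apply, one_mul, Nat.cast_add]
    linarith [hentry 0 w, hentry 1 w]
  rw [gxz_eq, Nat.cast_max]
  exact max_le (hcol 0) (hcol 1)

variable (Lx Lz) in
theorem tendsto_gxz_mul_of_lambdaMax {μ : ℝ} (hμ0 : 0 ≤ μ) (hμ : μ * lambdaMax Lx Lz < 1) :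
    Tendsto (fun T : ℕ => (gxz Lx Lz T : ℝ) * μ ^ T) atTop (𝓝 0) := by
  have hl : 0 ≤ lambdaMax Lx Lz := ENNReal.toReal_nonneg
  -- The strict inequality leaves room for a rate above the spectral radius, as Gelfand's formula
  -- requires.
  obtain ⟨r, hr, hμr⟩ : ∃ r, lambdaMax Lx Lz < r ∧ μ * r < 1 := by
    have hc : ContinuousAt (fun r => μ * r) (lambdaMax Lx Lz) := by fun_prop
    have h1 := (hc.tendsto.eventually_lt_const hμ).filter_mono
      (nhdsWithin_le_nhds (s := Set.Ioi (lambdaMax Lx Lz)))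
    obtain ⟨r, h2, h3⟩ := (h1.and self_mem_nhdsWithin).exists
    exact ⟨r, h3, h2⟩
  have h0 : Tendsto (fun T : ℕ => 2 * (μ * r) ^ T) atTop (𝓝 0) := by
    simpa using (tendsto_pow_atTop_nhds_zero_of_lt_one
      (mul_nonneg hμ0 (hl.trans hr.le)) hμr).const_mul 2
  refine squeeze_zero' (Eventually.of_forall fun T => by positivity) ?_ h0
  filter_upwards [eventually_gxz_le Lx Lz (hl.trans_lt hr) hr] with T hT
  calc (gxz Lx Lz T : ℝ) * μ ^ T ≤ 2 * r ^ T * μ ^ T := by gcongr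
    _ = 2 * (μ * r) ^ T := by rw [mul_pow]; ring

variable (Lx Lz) in
theorem tendsto_gxz_mul_of_bMax {μ : ℝ} (hμ0 : 0 ≤ μ) (hμ : μ * bMax Lx Lz < 1) :
    Tendsto (fun T : ℕ => (gxz Lx Lz T : ℝ) * μ ^ T) atTop (𝓝 0) := by
  have h0 := tendsto_pow_atTop_nhds_zero_of_lt_one (by positivity) hμ
  refine squeeze_zero (fun T => by positivity) (fun T => ?_) h0
  rw [mul_pow, mul_comm]
  gcongr
  exact_mod_cast gxz_le_bMax_pow Lx Lz T

/-! ### Anti-standard encoders -/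

theorem XZString.count_eq_zero {ι : Type} [Fintype ι] {L : XZString ι} {a : Letter}
    (h : ∀ k, L.letter k ≠ a) : L.count a = 0 := by
  rw [count, Finset.card_eq_zero]
  exact Finset.filter_false_of_mem fun k _ => h k

theorem lambdaMax_eq_sqrt (hx : Lx.count .X = 0) (hz : Lz.count .Z = 0) :
    lambdaMax Lx Lz = √((Lx.weight : ℝ) * (Lz.weight : ℝ)) := by
  set s := √((Lx.weight : ℝ) * (Lz.weight : ℝ)) with hs
  have hs2 : s ^ 2 = (Lx.weight : ℝ) * (Lz.weight : ℝ) := Real.sq_sqrt (by positivity)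
  -- The matrix has zero diagonal, so its characteristic polynomial is `z² - d_x d_z`.
  have hmem : ∀ z : ℂ, z ∈ spectrum ℂ ((weightMatrix Lx Lz).map (Nat.cast : ℕ → ℂ)) ↔
      z ^ 2 = ((s ^ 2 : ℝ) : ℂ) := by
    intro z
    rw [spectrum.mem_iff, isUnit_iff_isUnit_det, isUnit_iff_ne_zero, not_not, det_fin_two, hs2,
      XZString.weight_eq, XZString.weight_eq, hx, hz]
    simp only [weightMatrix, hx, hz, Matrix.algebraMap_eq_diagonal]
    simp [sub_eq_zero, mul_comm, sq]
  have hnorm : ∀ z ∈ spectrum ℂ ((weightMatrix Lx Lz).map (Nat.cast : ℕ → ℂ)), ‖z‖ = s := by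
    intro z hz
    have h := congrArg norm ((hmem z).1 hz)
    rw [norm_pow, Complex.norm_real, Real.norm_of_nonneg (sq_nonneg s)] at h
    exact (pow_left_inj₀ (norm_nonneg _) (Real.sqrt_nonneg _) two_ne_zero).1 h
  have hrad : spectralRadius ℂ ((weightMatrix Lx Lz).map (Nat.cast : ℕ → ℂ)) =
      ENNReal.ofReal s := by
    apply le_antisymm
    · refine iSup₂_le fun z hz => ?_
      rw [← hnorm z hz, ofReal_norm]
      rfl
    · have h := (hmem s).2 (by push_cast; rfl)
      refine le_trans (le_of_eq ?_) (le_iSup₂ (f := fun (z : ℂ)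
        (_ : z ∈ spectrum ℂ ((weightMatrix Lx Lz).map (Nat.cast : ℕ → ℂ))) => (‖z‖₊ : ENNReal))
        (s : ℂ) h)
      rw [← hnorm s h, ofReal_norm]
      simp [enorm]
  rw [lambdaMax, hrad, ENNReal.toReal_ofReal (Real.sqrt_nonneg _)]

/-- Since `D` is off-diagonal, each step swaps the two column sums, multiplying the one that becomes
`x` by `d_x` and the other by `d_z`. Here `(T + 1) / 2` is the ceiling of `T / 2`. -/
theorem gxz_eq_of_count (hx : Lx.count .X = 0) (hz : Lz.count .Z = 0) (T : ℕ) :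
    gxz Lx Lz T = max (Lx.weight ^ ((T + 1) / 2) * Lz.weight ^ (T / 2))
      (Lz.weight ^ ((T + 1) / 2) * Lx.weight ^ (T / 2)) := by
  have h : (1 ᵥ* weightMatrix Lx Lz ^ T) 0 = Lx.weight ^ ((T + 1) / 2) * Lz.weight ^ (T / 2) ∧
      (1 ᵥ* weightMatrix Lx Lz ^ T) 1 = Lz.weight ^ ((T + 1) / 2) * Lx.weight ^ (T / 2) := by
    induction T with
    | zero => simp
    | succ T ih =>
      have hdiv : (T + 1 + 1) / 2 = T / 2 + 1 := by omega
      rw [one_vecMul_pow_succ, one_vecMul_pow_succ, ih.1, ih.2, hdiv]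
      simp only [cons_val_zero, cons_val_one, cons_val_fin_one, XZString.weight_eq, hx, hz]
      constructor <;> ring
  rw [gxz_eq, h.1, h.2]

end

end QuantumTree

end

theorem proposition2 (b : ℕ) (V : Matrix (Fin b → Fin 2) (Fin 2) ℂ) (hV : Vᴴ * V = 1)
    (Lx Lz : XZString (Fin b)) (hLx : IsLogical V Lx pauliX) (hLz : IsLogical V Lz pauliZ)
    (p : ℝ) (hp0 : 0 ≤ p) (hp1 : p ≤ 1) :
    -- the bound on the trace distance
    (∀ (T : ℕ) (ρ : QubitOp), IsDensity ρ →
      traceNorm (treeChannel (xzNoise p) V T ρ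
          - treeChannel (xzNoise p) V T ((1 / 2 : ℂ) • (1 : QubitOp)))
        ≤ 2 * √2 * √(gxz Lx Lz T : ℝ) * |1 - 2 * p| ^ T) ∧
    -- the bound on the growth of the weights
    (∀ T : ℕ, gxz Lx Lz T ≤ bMax Lx Lz ^ T) ∧
    -- the concatenated operators are logical operators at level `T`, of weight at most `g(T)`
    (∀ T : ℕ,
      IsLogical (treeIsometry V T) (concatLogical Lx Lz .X T) pauliX ∧
      IsLogical (treeIsometry V T) (concatLogical Lx Lz .Z T) pauliZ ∧
      (concatLogical Lx Lz .X T).weight ≤ gxz Lx Lz T ∧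
      (concatLogical Lx Lz .Z T).weight ≤ gxz Lx Lz T) ∧
    -- the threshold
    ((1 - 2 * p) ^ 2 * min (lambdaMax Lx Lz) (bMax Lx Lz : ℝ) < 1 →
      OutputBecomesIndependent (xzNoise p) V) ∧
    -- anti-standard encoders: `L_x` contains only `σ_z`, and `L_z` contains only `σ_x`
    ((∀ k, Lx.letter k ≠ .X) → (∀ k, Lz.letter k ≠ .Z) →
      lambdaMax Lx Lz = √((Lx.weight : ℝ) * (Lz.weight : ℝ)) ∧
      (∀ T : ℕ, gxz Lx Lz T =
        max (Lx.weight ^ ((T + 1) / 2) * Lz.weight ^ (T / 2))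
          (Lz.weight ^ ((T + 1) / 2) * Lx.weight ^ (T / 2))) ∧
      ((1 - 2 * p) ^ 2 * √((Lx.weight : ℝ) * (Lz.weight : ℝ)) < 1 →
        OutputBecomesIndependent (xzNoise p) V)) := by
  have hlambda := fun h => outputBecomesIndependent_of_tendsto hV hLx hLz hp0 hp1
    (tendsto_gxz_mul_of_lambdaMax Lx Lz (sq_nonneg (1 - 2 * p)) h)
  refine ⟨fun T ρ hρ => traceNorm_treeChannel_sub_le hV hLx hLz hp0 hp1 T hρ,
    gxz_le_bMax_pow Lx Lz, fun T => ⟨isLogical_concatLogical hLx hLz .X T,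
      isLogical_concatLogical hLx hLz .Z T, weight_concatLogical_le Lx Lz 0 T,
      weight_concatLogical_le Lx Lz 1 T⟩, fun h => ?_, fun hx hz => ?_⟩
  -- The minimum is one of the two growth rates, and either rate suffices by itself.
  · rcases min_choice (lambdaMax Lx Lz) (bMax Lx Lz : ℝ) with hm | hm <;> rw [hm] at h
    · exact hlambda h
    · exact outputBecomesIndependent_of_tendsto hV hLx hLz hp0 hp1
        (tendsto_gxz_mul_of_bMax Lx Lz (sq_nonneg (1 - 2 * p)) h)
  · have hx := XZString.count_eq_zero hx
    have hz := XZString.count_eq_zero hz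
    have hl := lambdaMax_eq_sqrt hx hz
    exact ⟨hl, gxz_eq_of_count hx hz, fun h => hlambda (by rwa [hl])⟩
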